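/- Let $p$ be an odd prime, let $\mathbb{K}$ be the unramified quadratic extension of $\mathbb{Q}_p$ with ring of integers $\mathcal{O}$, and let $G=\mathrm{PGL}_2(\mathbb{K})$ and $H=\mathrm{PGL}_2(\mathbb{Q}_p)$. Let $T$ be the Bruhat–Tits tree of $G$, with vertex set $G/\mathrm{PGL}_2(\mathcal{O})$ (homothety classes of lattices in $\mathbb{K}^2$). Its visual boundary is identified with $\mathbb{K}\cup\{\infty\}$, on which $G$ acts by Möbius transformations. Let $\mathcal{C}=\{g.(\mathbb{Q}_p\cup\{\infty\}) : g\in G\}$ be the space of circles, with the quotient topology of $G$ under the identification $\mathcal{C}=G/H$. Let $\Gamma\subset G$ be a Schottky group: $\Gamma$ is generated by $n\ge 2$ hyperbolic elements $\gamma_1,\dots,\gamma_n$, with translation lengths $\ell_1,\dots,\ell_n$, and for each $i$ the vertices of the axis of $\gamma_i$ can be labelled consecutively $(\mathbf{v}^i_j)_{j\in\mathbb{Z}}$ from the repelling to the attracting fixed point so that the $2n$ sets $$O_i^+=\{\mathbf{v}: d(\mathbf{v},\mathbf{v}^i_{\ell_i+1})<d(\mathbf{v},\mathbf{v}^i_{\ell_i})\},\qquad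 O_i^-=\{\mathbf{v}: d(\mathbf{v},\mathbf{v}^i_0)<d(\mathbf{v},\mathbf{v}^i_1)\}\qquad(1\le i\le n)$$ of vertices are mutually disjoint. For a subgroup $\Delta$ of $G$, the limit set $\Lambda(\Delta)\subset\mathbb{K}\cup\{\infty\}$ is the set of boundary points of $T$ that lie in the closure of the orbit $\Delta.\mathbf{v}$ of a vertex $\mathbf{v}$ in the compactification of $T$ by its boundary (it does not depend on $\mathbf{v}$). Let $\Lambda=\Lambda(\Gamma)$. **Theorem.** Let $C\in\mathcal{C}$ and let $\Gamma^C=\{\gamma\in\Gamma : \gamma C=C\}$. If the orbit $\Gamma C$ is closed in $\mathcal{C}$ and $C\cap\Lambda\neq\varnothing$, then $\Gamma^C$ is finitely generated and $C\cap\Lambda=\Lambda(\Gamma^C)$. -/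

import Mathlib

open scoped Pointwise MatrixGroups LinearAlgebra.Projectivization

namespace BruhatTits

noncomputable section

/-- `K` is an unramified quadratic extension of `ℚ_p`: it has degree two, and `p` is still a
uniformizer, that is, the absolute value of `K` takes no new values (ramification index one). The
norm of `K` is the multiplicative norm which extends the `p`-adic one. -/
structure IsUnramifiedQuadratic (p : ℕ) [Fact p.Prime] (K : Type*) [NormedField K]
    [NormedAlgebra ℚ_[p] K] : Prop where
  finrank_eq_two : Module.finrank ℚ_[p] K = 2
  unramified : ∀ x : K, ∃ y : ℚ_[p], ‖x‖ = ‖y‖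

/-- `PGL₂(K)` with the quotient topology of `GL₂(K)`. -/
instance pglTopology (K : Type*) [NormedField K] : TopologicalSpace PGL(2, K) :=
  TopologicalSpace.coinduced (Matrix.ProjGenLinGroup.mk : GL (Fin 2) K → PGL(2, K)) inferInstance

lemma isUltrametricDist (p : ℕ) [Fact p.Prime] (K : Type*) [NormedField K]
    [NormedAlgebra ℚ_[p] K] : IsUltrametricDist K := by
  refine IsUltrametricDist.isUltrametricDist_of_forall_norm_natCast_le_one fun n => ?_
  have h : ‖algebraMap ℚ_[p] K (n : ℚ_[p])‖ ≤ 1 := by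
    rw [norm_algebraMap']
    exact IsUltrametricDist.norm_natCast_le_one ℚ_[p] n
  simpa using h

variable (p : ℕ) [Fact p.Prime] (K : Type*) [NormedField K] [NormedAlgebra ℚ_[p] K]

/-- The ring of integers `{x : ‖x‖ ≤ 1}` of `K`. -/
def ringOfIntegers : Subring K where
  carrier := {x | ‖x‖ ≤ 1}
  mul_mem' {a b} ha hb := by
    change ‖a * b‖ ≤ 1
    rw [norm_mul]
    exact mul_le_one₀ ha (norm_nonneg b) hb
  one_mem' := by simp
  add_mem' {a b} ha hb := by
    have := isUltrametricDist p K
    exact (IsUltrametricDist.norm_add_le_max a b).trans (max_le ha hb)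
  zero_mem' := by simp
  neg_mem' {a} ha := by simpa using ha

/-- The uniformizer `p` as a unit of `K`. -/
def unif : Kˣ :=
  Units.map (algebraMap ℚ_[p] K).toMonoidHom
    (Units.mk0 (p : ℚ_[p]) (Nat.cast_ne_zero.mpr (Fact.out : p.Prime).ne_zero))

variable {K} in
/-- The class of the diagonal matrix `diag(a, 1)` in `PGL₂(K)`. -/
def diagElt (a : Kˣ) : PGL(2, K) :=
  Matrix.ProjGenLinGroup.mk
    (Matrix.GeneralLinearGroup.mkOfDetNeZero !![(a : K), 0; 0, 1] (by simp))

/-! ### The Bruhat-Tits tree -/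

/-- `PGL₂(𝒪)`, the image of `GL₂(𝒪)` in `PGL₂(K)`. -/
def maxCompact : Subgroup PGL(2, K) :=
  (Matrix.GeneralLinearGroup.map (n := Fin 2) (ringOfIntegers p K).subtype).range.map
    Matrix.ProjGenLinGroup.mk

/-- The vertices `PGL₂(K) / PGL₂(𝒪)`, with the left action of `PGL₂(K)`. -/
abbrev Vertex : Type _ := PGL(2, K) ⧸ maxCompact p K

variable {K} in
/-- The lattice `A 𝒪²` of `K²`, spanned by the columns of `A`. -/
def lattice (A : GL (Fin 2) K) : Set (Fin 2 → K) :=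
  (fun x => (A : Matrix (Fin 2) (Fin 2) K).mulVec x) '' {x | ∀ i, x i ∈ ringOfIntegers p K}

/-- The vertex of `A`; it stands for the lattice `A 𝒪²` up to homothety. -/
def vertexOf (A : GL (Fin 2) K) : Vertex p K :=
  QuotientGroup.mk (Matrix.ProjGenLinGroup.mk A)

/-- The Bruhat-Tits tree of `PGL₂(K)`: two homothety classes of lattices are adjacent if they have
representatives with `p L ⊊ M ⊊ L`. -/
def tree : SimpleGraph (Vertex p K) :=
  SimpleGraph.fromRel fun v w => ∃ A B : GL (Fin 2) K,
    vertexOf p K A = v ∧ vertexOf p K B = w ∧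
      (unif p K : K) • lattice p A ⊂ lattice p B ∧ lattice p B ⊂ lattice p A

variable {K} in
/-- For adjacent `v`, `w`, the branch at `v` in the direction of `w`: all vertices which are
closer to `w` than to `v`. -/
def branch (v w : Vertex p K) : Set (Vertex p K) :=
  {x | (tree p K).dist x w < (tree p K).dist x v}

/-- The reference geodesic `j ↦ [diag(p ^ j, 1)]`; it tends to `0` for `j → ∞` and to the point
`∞` of the boundary for `j → -∞`. -/
def refVertex (j : ℤ) : Vertex p K := QuotientGroup.mk (diagElt (unif p K ^ j))

/-! ### The boundary, limit sets, circles

The boundary of the tree is the projective line `ℙ K (Fin 2 → K) = K ∪ {∞}` on which `PGL₂(K)` acts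
by Möbius transformations; the end of the ray `j ↦ g • refVertex (-j)` is the point `g • ∞`. -/

/-- The point `∞ = [1 : 0]`. -/
def infPt : ℙ K (Fin 2 → K) := Projectivization.mk K ![1, 0] (by simp)

variable {K} in
/-- The point `a = [a : 1]` for `a` in `K`. -/
def finPt (a : K) : ℙ K (Fin 2 → K) := Projectivization.mk K ![a, 1] (by simp)

variable {K} in
/-- The limit set of `Γ`: all boundary points which lie in the closure of the orbit of the origin.
A point `g • ∞` has as a neighbourhood basis in the compactified tree the branches at the vertices
of a ray that tends to it, in the direction of the next vertex of the ray. -/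
def limitSet (Γ : Subgroup PGL(2, K)) : Set (ℙ K (Fin 2 → K)) :=
  {α | ∃ g : PGL(2, K), g • infPt K = α ∧ ∀ n : ℕ, ∃ γ ∈ Γ,
    γ • refVertex p K 0 ∈ branch p (g • refVertex p K (-n)) (g • refVertex p K (-(n + 1)))}

/-- The projective line `ℚ_p ∪ {∞}` inside `K ∪ {∞}`. -/
def qpLine : Set (ℙ K (Fin 2 → K)) :=
  insert (infPt K) (Set.range fun a : ℚ_[p] => finPt (algebraMap ℚ_[p] K a))

/-- The space of circles, that is of the translates of `ℚ_p ∪ {∞}` under `PGL₂(K)`. -/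
def CircleSpace : Type _ := MulAction.orbit PGL(2, K) (qpLine p K)

/-- `PGL₂(K)` acts on circles by translation. -/
instance : MulAction PGL(2, K) (CircleSpace p K) :=
  inferInstanceAs (MulAction PGL(2, K) (MulAction.orbit PGL(2, K) (qpLine p K)))

variable {p K} in
/-- The set of points of a circle. -/
def CircleSpace.points (C : CircleSpace p K) : Set (ℙ K (Fin 2 → K)) := C.1

/-- The circle `g (ℚ_p ∪ {∞})`. -/
def mkCircle (g : PGL(2, K)) : CircleSpace p K :=
  ⟨g • qpLine p K, MulAction.mem_orbit _ g⟩

/-- The topology of the space of circles is the quotient topology of `PGL₂(K)`: since the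
stabilizer of `ℚ_p ∪ {∞}` is `PGL₂(ℚ_p)`, the space is `PGL₂(K) / PGL₂(ℚ_p)`. -/
instance : TopologicalSpace (CircleSpace p K) :=
  TopologicalSpace.coinduced (mkCircle p K) inferInstance

variable {p K} in
/-- The stabilizer of the circle `C` in `Γ`, as a subgroup of `PGL₂(K)`. -/
def circleStabilizer (Γ : Subgroup PGL(2, K)) (C : CircleSpace p K) : Subgroup PGL(2, K) :=
  Γ ⊓ MulAction.stabilizer PGL(2, K) C

/-! ### Schottky groups -/

variable {K} in
/-- `γ` is hyperbolic with translation length `n ≥ 1`, that is, it is conjugate to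
`diag(p ^ (-n) * a, 1)` with a unit `a` of the ring of integers, and `v` is a labelling of the
vertices of its axis, in order, from the repelling to the attracting fixed point. (Shifts of the
labelling come from replacing `g` by `g * diag(p ^ k, 1)`.) -/
def IsAxisLabelling (γ : PGL(2, K)) (n : ℕ) (v : ℤ → Vertex p K) : Prop :=
  1 ≤ n ∧ ∃ (g : PGL(2, K)) (a : Kˣ), ‖(a : K)‖ = 1 ∧
    γ = g * diagElt (unif p K ^ (-(n : ℤ)) * a) * g⁻¹ ∧
    ∀ j : ℤ, v j = g • refVertex p K (-j)

variable {K} in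
/-- `γ₁, …, γₙ` is a Schottky basis: the axes of these hyperbolic elements can be labelled so that
the `2n` sets `O⁺ᵢ` (the branch at the vertex with label `ℓᵢ`, the translation length, towards the
one with label `ℓᵢ + 1`) and `O⁻ᵢ` (the branch at the vertex with label `1` towards the one with
label `0`) are mutually disjoint. -/
def IsSchottkyBasis {n : ℕ} (γ : Fin n → PGL(2, K)) : Prop :=
  ∃ (len : Fin n → ℕ) (v : Fin n → ℤ → Vertex p K),
    (∀ i, IsAxisLabelling p (γ i) (len i) (v i)) ∧
    Pairwise (Function.onFun Disjoint
      (Sum.elim (fun i => branch p (v i (len i)) (v i (len i + 1)))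
        (fun i => branch p (v i 1) (v i 0))))

variable {K} in
/-- A Schottky group is a subgroup generated by a Schottky basis with at least two elements. -/
def IsSchottky (Γ : Subgroup PGL(2, K)) : Prop :=
  ∃ (n : ℕ) (γ : Fin n → PGL(2, K)), 2 ≤ n ∧ IsSchottkyBasis p γ ∧
    Γ = Subgroup.closure (Set.range γ)

end

end BruhatTits

/-!
The proof takes place in the Bruhat-Tits tree. The subtree of `C` is the translate of the tree of
`PGL₂(ℚ_p)`, and the orbit of the origin under `Γ` has a neighbourhood which is a subtree with
finitely many `Γ`-orbits of vertices. Let `S` be the intersection of these two subtrees. The point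
is that the stabilizer `Γ^C` acts on `S` with finitely many orbits:

* The orbit `Γ C` is countable and closed, so by the Baire category theorem it is discrete
  (`exists_nhds_of_isClosed_orbit`). The circles through a given vertex form a compact set, so only
  finitely many of them lie in `Γ C` (`finite_circles_through`). Moving a vertex of `S` by an
  element of `Γ` into a finite set of representatives thus takes `C` to one of finitely many
  circles, and two vertices with the same representative and the same circle differ by an element of `Γ^C`
  (`exists_finite_fundamental_set`).

A ray of the subtree of `C` which tends to a point of `C ∩ Λ` eventually runs inside `S`, since
convex sets contain a tail of each ray to whose end they accumulate. As its vertices are within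
bounded distance of the orbit of the origin under `Γ^C`, its end is a limit point of `Γ^C`. In
particular `S` is not empty; since a Schottky group acts properly, by ping-pong, the group `Γ^C`
acts properly and cocompactly on the subtree `S` and is finitely generated. Conversely, the limit
set of `Γ^C` lies on `C` because `Γ^C` preserves the subtree of `C`, and the ends of this subtree
are the points of `C` by the completeness of `ℚ_p` (`smul_infPt_mem_points`).

The geometry of the tree is reduced to matrices by the function
`distortion A = max |aᵢⱼ|² / |det A|`, which equals `p ^ d` for `d` the distance between the origin
and its image under `A` (`distortion_eq_pow_dist`). All that is used of trees is the separation
property of edges, which follows from the uniqueness of the neighbour closer to a given root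
(`tree_uniqueDescent`).
-/

/-! ### Graphs with unique descent -/

namespace SimpleGraph

variable {V : Type*} {T : SimpleGraph V}

/-- A connected graph in which, for every root `x`, each vertex `v` has at most one neighbour that
is closer to `x`, and all its other neighbours are further away. These are the trees; the condition
is the form in which the structure is read off from matrices. -/
structure UniqueDescent (T : SimpleGraph V) : Prop where
  connected : T.Connected
  descent : ∀ x v, ∃ u, ∀ w, T.Adj v w →
    T.dist x w = T.dist x v + 1 ∨ (w = u ∧ T.dist x w + 1 = T.dist x v)

/-- The vertices which are closer to `w` than to `v`. -/
def half (T : SimpleGraph V) (v w : V) : Set V := {x | T.dist x w < T.dist x v}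

/-- A set of vertices which contains both ends of each edge that separates two of its members.
In a tree these are the vertex sets of subtrees, and in this form the notion is visibly stable
under intersections. -/
def SeparationConvex (T : SimpleGraph V) (X : Set V) : Prop :=
  ∀ ⦃v w⦄, T.Adj v w → ∀ ⦃x y⦄, x ∈ X → y ∈ X → x ∈ T.half v w → y ∈ T.half w v → v ∈ X ∧ w ∈ X

lemma SeparationConvex.inter {X Y : Set V} (hX : T.SeparationConvex X)
    (hY : T.SeparationConvex Y) : T.SeparationConvex (X ∩ Y) := fun _ _ h _ _ hx hy h1 h2 =>
  ⟨⟨(hX h hx.1 hy.1 h1 h2).1, (hY h hx.2 hy.2 h1 h2).1⟩,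
    ⟨(hX h hx.1 hy.1 h1 h2).2, (hY h hx.2 hy.2 h1 h2).2⟩⟩

lemma exists_adj_dist_add_one (hT : T.Connected) {x y : V} (h : x ≠ y) :
    ∃ z, T.Adj x z ∧ T.dist z y + 1 = T.dist x y := by
  obtain ⟨q, hq⟩ := hT.exists_walk_length_eq_dist x y
  cases q with
  | nil => exact absurd rfl h
  | cons hadj q =>
    rename_i z
    refine ⟨z, hadj, ?_⟩
    have h1 : T.dist z y ≤ q.length := dist_le q
    have h2 : T.dist x y ≤ T.dist x z + T.dist z y := hT.dist_triangle
    have h3 : T.dist x z = 1 := dist_eq_one_iff_adj.mpr hadj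
    simp only [Walk.length_cons] at hq
    omega

namespace UniqueDescent

variable (hT : T.UniqueDescent)
include hT

lemma dist_eq_or {v w : V} (h : T.Adj v w) (x : V) :
    T.dist x w = T.dist x v + 1 ∨ T.dist x v = T.dist x w + 1 := by
  obtain ⟨u, hu⟩ := hT.descent x v
  rcases hu w h with h | ⟨-, h⟩
  · exact .inl h
  · exact .inr h.symm

lemma eq_of_dist_lt {v w w' x : V} (h : T.Adj v w) (h' : T.Adj v w')
    (hw : T.dist x w < T.dist x v) (hw' : T.dist x w' < T.dist x v) : w = w' := by
  obtain ⟨u, hu⟩ := hT.descent x v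
  rcases hu w h with h1 | ⟨h1, -⟩
  · omega
  rcases hu w' h' with h2 | ⟨h2, -⟩
  · omega
  rw [h1, h2]

lemma mem_half_swap {v w x : V} (h : T.Adj v w) (hx : x ∉ T.half v w) : x ∈ T.half w v := by
  have := hT.dist_eq_or h x
  simp only [half, Set.mem_ofPred_eq] at hx ⊢
  omega

omit hT in
lemma notMem_half_swap {v w x : V} (hx : x ∈ T.half v w) : x ∉ T.half w v := by
  simp only [half, Set.mem_ofPred_eq] at hx ⊢
  omega

omit hT in
lemma right_mem_half {v w : V} (h : T.Adj v w) : w ∈ T.half v w := by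
  simp [half, dist_eq_one_iff_adj.mpr h.symm]

/-- The only edge between the two halves determined by an edge is that edge. -/
lemma eq_of_adj_of_mem_half {v w x y : V} (h : T.Adj v w) (hxy : T.Adj x y)
    (hx : x ∈ T.half v w) (hy : y ∈ T.half w v) : x = w ∧ y = v := by
  have hx' := hT.dist_eq_or h x
  have hy' := hT.dist_eq_or h y
  simp only [half, Set.mem_ofPred_eq] at hx hy
  have h1 := hT.connected.dist_triangle (u := y) (v := x) (w := w)
  have h2 := hT.connected.dist_triangle (u := x) (v := y) (w := v)
  have h3 : T.dist x y = 1 := dist_eq_one_iff_adj.mpr hxy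
  have h4 : T.dist y x = 1 := dist_eq_one_iff_adj.mpr hxy.symm
  rcases eq_or_ne x w with rfl | hne
  · refine ⟨rfl, ?_⟩
    rw [dist_self] at h1 hx'
    exact (hT.connected.dist_eq_zero_iff (u := y) (v := v)).mp (by omega)
  · exfalso
    obtain ⟨z, hz, hzw⟩ := exists_adj_dist_add_one hT.connected hne
    have h5 := hT.connected.dist_triangle (u := z) (v := w) (w := v)
    have h6 : T.dist w v = 1 := dist_eq_one_iff_adj.mpr h.symm
    have hzy : z = y := by
      refine hT.eq_of_dist_lt (x := v) hz hxy ?_ ?_ <;>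
        rw [dist_comm (u := v), dist_comm (u := v)] <;> omega
    rw [hzy] at hzw
    omega

lemma dist_eq_of_mem_half {v w : V} (h : T.Adj v w) {x y : V}
    (hx : x ∈ T.half v w) (hy : y ∈ T.half w v) :
    T.dist x y = T.dist x w + 1 + T.dist v y := by
  induction hn : T.dist x y using Nat.strong_induction_on generalizing x with
  | _ n ih =>
    have hne : x ≠ y := by
      rintro rfl
      exact notMem_half_swap hx hy
    obtain ⟨z, hz, hzy⟩ := exists_adj_dist_add_one hT.connected hne
    by_cases hzm : z ∈ T.half v w
    · have h1 := ih _ (by omega) hzm rfl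
      have h2 := hT.connected.dist_triangle (u := x) (v := z) (w := w)
      have h3 := hT.connected.dist_triangle (u := x) (v := w) (w := y)
      have h4 := hT.connected.dist_triangle (u := w) (v := v) (w := y)
      have h5 : T.dist w v = 1 := dist_eq_one_iff_adj.mpr h.symm
      have h6 : T.dist x z = 1 := dist_eq_one_iff_adj.mpr hz
      omega
    · obtain ⟨rfl, rfl⟩ := hT.eq_of_adj_of_mem_half h hz hx (hT.mem_half_swap h hzm)
      rw [dist_self]
      omega

/-- A set in which any two members are joined by a path inside the set is convex. -/
lemma separationConvex_of_paths {X : Set V}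
    (hX : ∀ x ∈ X, ∀ y ∈ X, ∃ (n : ℕ) (f : ℕ → V), f 0 = x ∧ f n = y ∧ (∀ i, f i ∈ X) ∧
      ∀ i, T.Adj (f i) (f (i + 1))) : T.SeparationConvex X := by
  intro v w h x y hx hy hxm hym
  obtain ⟨n, f, rfl, rfl, hf, hadj⟩ := hX x hx y hy
  have hex : ∃ m, f m ∉ T.half v w := ⟨n, fun hn => notMem_half_swap hn hym⟩
  classical
  obtain ⟨m, hm⟩ : ∃ m, Nat.find hex = m + 1 := by
    refine Nat.exists_eq_succ_of_ne_zero fun h0 => ?_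
    have := Nat.find_spec hex
    rw [h0] at this
    exact this hxm
  have h1 : f m ∈ T.half v w := by
    have := Nat.find_min hex (m := m) (by omega)
    simpa using this
  have h2 : f (m + 1) ∉ T.half v w := hm ▸ Nat.find_spec hex
  obtain ⟨h3, h4⟩ := hT.eq_of_adj_of_mem_half h (hadj m) h1 (hT.mem_half_swap h h2)
  exact ⟨h4 ▸ hf (m + 1), h3 ▸ hf m⟩

/-- In a convex set one can walk from `x` to `y` along a geodesic. -/
lemma exists_adj_mem {X : Set V} (hX : T.SeparationConvex X) {x y : V} (hx : x ∈ X) (hy : y ∈ X)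
    (hne : x ≠ y) : ∃ z ∈ X, T.Adj x z ∧ T.dist z y + 1 = T.dist x y := by
  obtain ⟨z, hz, hzy⟩ := exists_adj_dist_add_one hT.connected hne
  refine ⟨z, ?_, hz, hzy⟩
  refine (hX hz hy hx ?_ (right_mem_half hz.symm)).2
  simp only [half, Set.mem_ofPred_eq]
  rw [dist_comm, dist_comm (u := y)]
  omega

/-! ### Rays -/

section Ray

omit hT in
lemma exists_notMem_half (r : ℕ → V) (x : V) : ∃ n, x ∉ T.half (r n) (r (n + 1)) := by
  by_contra! h
  have key : ∀ n, T.dist x (r n) + n ≤ T.dist x (r 0) := by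
    intro n
    induction n with
    | zero => rfl
    | succ n ih =>
      have := h n
      simp only [half, Set.mem_ofPred_eq] at this
      omega
  have := key (T.dist x (r 0) + 1)
  omega

variable {r : ℕ → V} (hr : ∀ n, T.Adj (r n) (r (n + 1))) (hr' : ∀ n, r n ≠ r (n + 2))
include hr hr'

lemma half_ray_antitone : Antitone fun n => T.half (r n) (r (n + 1)) := by
  refine antitone_nat_of_succ_le fun n x hx => ?_
  by_contra hx'
  have h1 := hT.mem_half_swap (hr n) hx'
  exact hr' n (hT.eq_of_dist_lt (hr n).symm (hr (n + 1)) h1 hx)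

lemma dist_ray_add {x : V} {n : ℕ} (hx : x ∉ T.half (r n) (r (n + 1))) (k : ℕ) :
    T.dist x (r (n + k)) = T.dist x (r n) + k := by
  induction k with
  | zero => rfl
  | succ k ih =>
    have h1 : x ∉ T.half (r (n + k)) (r (n + k + 1)) := fun h =>
      hx (hT.half_ray_antitone hr hr' (Nat.le_add_right n k) h)
    have h2 := hT.dist_eq_or (hr (n + k)) x
    simp only [half, Set.mem_ofPred_eq] at h1
    rw [← add_assoc]
    omega

lemma mem_half_ray_of_dist_le {x y : V} {n m R : ℕ} (hxy : T.dist x y ≤ R) (hm : n + R ≤ m)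
    (hy : y ∈ T.half (r m) (r (m + 1))) : x ∈ T.half (r n) (r (n + 1)) := by
  by_contra hx
  obtain ⟨k, rfl⟩ := Nat.exists_eq_add_of_le (show n ≤ m by omega)
  have h1 : x ∉ T.half (r (n + k)) (r (n + k + 1)) := fun h =>
    hx (hT.half_ray_antitone hr hr' (Nat.le_add_right n k) h)
  have h2 := hT.dist_eq_of_mem_half (hr (n + k)) hy (hT.mem_half_swap (hr _) h1)
  have h3 := hT.dist_ray_add hr hr' hx k
  rw [dist_comm, dist_comm (u := r _) (v := x)] at h2
  omega

/-- A convex set which accumulates at the end of a ray contains a tail of the ray. -/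
lemma exists_forall_ray_mem {X : Set V} (hX : T.SeparationConvex X) {x : V} (hx : x ∈ X)
    (h : ∀ n, ∃ y ∈ X, y ∈ T.half (r n) (r (n + 1))) : ∃ N, ∀ n, N ≤ n → r n ∈ X := by
  obtain ⟨N, hN⟩ := exists_notMem_half r x
  refine ⟨N, fun n hn => ?_⟩
  obtain ⟨y, hy, hy'⟩ := h n
  have h1 : x ∉ T.half (r n) (r (n + 1)) := fun h => hN (hT.half_ray_antitone hr hr' hn h)
  exact (hX (hr n) hy hx hy' (hT.mem_half_swap (hr n) h1)).1

end Ray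

/-! ### Groups acting on trees -/

section Action

variable {G : Type*} [Group G] [MulAction G V]

/-- The `R`-neighbourhood of an orbit is convex, if each generator moves the base point by at
most `R`. -/
lemma separationConvex_nhds_orbit (hd : ∀ (g : G) (x y : V), T.dist (g • x) (g • y) = T.dist x y)
    {s : Set G} {x₀ : V} {R : ℕ} (hs : ∀ g ∈ s, T.dist x₀ (g • x₀) ≤ R) :
    T.SeparationConvex {x | ∃ g ∈ Subgroup.closure s, T.dist (g • x₀) x ≤ R} := by
  have close : ∀ {v w x y : V}, T.Adj v w → x ∈ T.half v w → y ∈ T.half w v → T.dist x y ≤ R →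
      T.dist x v ≤ R ∧ T.dist x w ≤ R ∧ T.dist y v ≤ R ∧ T.dist y w ≤ R := by
    intro v w x y h hx hy hxy
    have h1 := hT.dist_eq_of_mem_half h hx hy
    have h2 := hT.dist_eq_or h x
    have h3 := hT.dist_eq_or h y
    simp only [half, Set.mem_ofPred_eq] at hx hy
    rw [dist_comm (u := v)] at h1
    omega
  intro v w h x y hx hy hxm hym
  obtain ⟨g, hg, hgx⟩ := hx
  obtain ⟨k, hk, hky⟩ := hy
  by_cases h1 : g • x₀ ∈ T.half v w
  swap
  · have := close h hxm (hT.mem_half_swap h h1) (dist_comm (u := x) ▸ hgx)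
    exact ⟨⟨g, hg, this.2.2.1⟩, ⟨g, hg, this.2.2.2⟩⟩
  by_cases h2 : k • x₀ ∈ T.half v w
  · have := close h h2 hym hky
    exact ⟨⟨k, hk, this.1⟩, ⟨k, hk, this.2.1⟩⟩
  by_contra hcon
  refine h2 ?_
  -- Otherwise no step of the orbit crosses the edge, so that the orbit lies on one side of it.
  have step : ∀ u ∈ Subgroup.closure s, ∀ t, t ∈ s →
      (u • x₀ ∈ T.half v w ↔ (u * t) • x₀ ∈ T.half v w) := by
    intro u hu t ht
    have hdist : T.dist (u • x₀) ((u * t) • x₀) ≤ R := by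
      rw [mul_smul, hd]
      exact hs t ht
    by_contra hne
    apply hcon
    by_cases hu1 : u • x₀ ∈ T.half v w
    · have hu2 : (u * t) • x₀ ∉ T.half v w := fun h' => hne ⟨fun _ => h', fun _ => hu1⟩
      have := close h hu1 (hT.mem_half_swap h hu2) hdist
      exact ⟨⟨u, hu, this.1⟩, ⟨u, hu, this.2.1⟩⟩
    · have hu2 : (u * t) • x₀ ∈ T.half v w := by
        by_contra h'
        exact hne ⟨fun h => absurd h hu1, fun h => absurd h h'⟩
      rw [dist_comm] at hdist
      have := close h hu2 (hT.mem_half_swap h hu1) hdist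
      exact ⟨⟨u, hu, this.2.2.1⟩, ⟨u, hu, this.2.2.2⟩⟩
  have all : ∀ t ∈ Subgroup.closure s, ∀ u ∈ Subgroup.closure s,
      (u • x₀ ∈ T.half v w ↔ (u * t) • x₀ ∈ T.half v w) := by
    intro t ht
    induction ht using Subgroup.closure_induction with
    | mem t ht => exact fun u hu => step u hu t ht
    | one => simp
    | mul a b ha _ iha ihb =>
      intro u hu
      rw [iha u hu, ihb _ (mul_mem hu ha), mul_assoc]
    | inv a ha iha =>
      intro u hu
      rw [iha (u * a⁻¹) (mul_mem hu (inv_mem ha)), inv_mul_cancel_right]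
  have := (all (g⁻¹ * k) (mul_mem (inv_mem hg) hk) g hg).mp h1
  rwa [mul_inv_cancel_left] at this

/-- A group which acts properly and cocompactly on a subtree is finitely generated. -/
lemma fg_of_cocompact (hd : ∀ (g : G) (x y : V), T.dist (g • x) (g • y) = T.dist x y)
    {Δ : Subgroup G} {S F : Set V} (hS : T.SeparationConvex S) (hne : S.Nonempty)
    (hinv : ∀ g ∈ Δ, ∀ x ∈ S, g • x ∈ S)
    (hF : F.Finite) (hFS : F ⊆ S) (hcov : ∀ x ∈ S, ∃ g ∈ Δ, ∃ f ∈ F, x = g • f)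
    (hproper : ∀ f ∈ F, ∀ f' ∈ F, {g | g ∈ Δ ∧ T.dist (g • f) f' ≤ 1}.Finite) : Δ.FG := by
  obtain ⟨f₀, hf₀⟩ : F.Nonempty := by
    obtain ⟨x, hx⟩ := hne
    obtain ⟨-, -, f, hf, -⟩ := hcov x hx
    exact ⟨f, hf⟩
  set Q : Set G := ⋃ f ∈ F, ⋃ f' ∈ F, {g | g ∈ Δ ∧ T.dist (g • f) f' ≤ 1} with hQ
  have hmemQ : ∀ {g f f'}, f ∈ F → f' ∈ F → g ∈ Δ → T.dist (g • f) f' ≤ 1 →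
      g ∈ Subgroup.closure Q := by
    intro g f f' hf hf' hg hgf
    refine Subgroup.subset_closure ?_
    simp only [hQ, Set.mem_iUnion]
    exact ⟨f, hf, f', hf', hg, hgf⟩
  have hQfin : Q.Finite := hF.biUnion fun f hf => hF.biUnion fun f' hf' => hproper f hf f' hf'
  rw [Subgroup.fg_iff]
  refine ⟨Q, le_antisymm ?_ ?_, hQfin⟩
  · rw [Subgroup.closure_le]
    intro g hg
    simp only [hQ, Set.mem_iUnion] at hg
    obtain ⟨f, -, f', -, hg, -⟩ := hg
    exact hg
  have main : ∀ n : ℕ, ∀ g ∈ Δ, ∀ f ∈ F, g • f ∈ S → T.dist (g • f) f₀ = n →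
      g ∈ Subgroup.closure Q := by
    intro n
    induction n with
    | zero => exact fun g hg f hf _ h0 => hmemQ hf hf₀ hg (by omega)
    | succ n ih =>
      intro g hg f hf hgf hn
      have hne : g • f ≠ f₀ := by
        intro h
        rw [h, dist_self] at hn
        omega
      obtain ⟨z, hzS, hadj, hz⟩ := hT.exists_adj_mem hS hgf (hFS hf₀) hne
      obtain ⟨k, hk, f', hf', rfl⟩ := hcov z hzS
      have hkQ := ih k hk f' hf' hzS (by omega)
      have : k⁻¹ * g ∈ Subgroup.closure Q := by
        refine hmemQ hf hf' (mul_mem (inv_mem hk) hg) ?_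
        rw [← hd k, ← mul_smul, mul_inv_cancel_left]
        exact (dist_eq_one_iff_adj.mpr hadj).le
      simpa using mul_mem hkQ this
  exact fun g hg => main _ g hg f₀ hf₀ (hinv g hg _ (hFS hf₀)) rfl

end Action

end UniqueDescent

end SimpleGraph

/-! ### The distortion of a matrix -/

namespace BruhatTits

section Distortion

variable {K : Type*} [NormedField K]

/-- The largest absolute value of an entry of `A`. -/
noncomputable def entryNorm (A : Matrix (Fin 2) (Fin 2) K) : ℝ :=
  max (max ‖A 0 0‖ ‖A 0 1‖) (max ‖A 1 0‖ ‖A 1 1‖)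

lemma entryNorm_le_iff {A : Matrix (Fin 2) (Fin 2) K} {r : ℝ} :
    entryNorm A ≤ r ↔ ∀ i j, ‖A i j‖ ≤ r := by
  simp [entryNorm, Fin.forall_fin_two, and_assoc]

lemma norm_le_entryNorm (A : Matrix (Fin 2) (Fin 2) K) (i j : Fin 2) : ‖A i j‖ ≤ entryNorm A :=
  entryNorm_le_iff.mp le_rfl i j

lemma exists_norm_eq_entryNorm (A : Matrix (Fin 2) (Fin 2) K) : ∃ i j, ‖A i j‖ = entryNorm A := by
  by_contra! h
  have h' : ∀ i j, ‖A i j‖ < entryNorm A := fun i j => (norm_le_entryNorm A i j).lt_of_ne (h i j)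
  have : entryNorm A < entryNorm A :=
    max_lt (max_lt (h' 0 0) (h' 0 1)) (max_lt (h' 1 0) (h' 1 1))
  exact this.false

lemma entryNorm_nonneg (A : Matrix (Fin 2) (Fin 2) K) : 0 ≤ entryNorm A :=
  (norm_nonneg _).trans (norm_le_entryNorm A 0 0)

lemma entryNorm_smul (c : K) (A : Matrix (Fin 2) (Fin 2) K) :
    entryNorm (c • A) = ‖c‖ * entryNorm A := by
  simp [entryNorm, mul_max_of_nonneg _ _ (norm_nonneg c)]

lemma entryNorm_adjugate (A : Matrix (Fin 2) (Fin 2) K) : entryNorm A.adjugate = entryNorm A := by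
  apply le_antisymm <;> rw [entryNorm_le_iff]
  · intro i j
    rw [Matrix.adjugate_fin_two]
    fin_cases i <;> fin_cases j <;> simp [norm_le_entryNorm]
  · have := fun i j => norm_le_entryNorm A.adjugate i j
    rw [Matrix.adjugate_fin_two] at this ⊢
    intro i j
    fin_cases i <;> fin_cases j
    · simpa using this 1 1
    · simpa using this 0 1
    · simpa using this 1 0
    · simpa using this 0 0

lemma continuous_entryNorm : Continuous (entryNorm : Matrix (Fin 2) (Fin 2) K → ℝ) := by
  unfold entryNorm
  fun_prop

lemma norm_det_pos (A : GL (Fin 2) K) : 0 < ‖A.1.det‖ :=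
  norm_pos_iff.mpr (Matrix.GeneralLinearGroup.det A).ne_zero

/-- The distortion `max |aᵢⱼ|² / |det A|` of an invertible matrix. It depends only on the class of
`A` in `PGL₂(𝒪) \ PGL₂(K) / PGL₂(𝒪)`, and equals `p ^ d` for `d` the distance from the origin of
the tree to its image under `A`. -/
noncomputable def distortion (A : GL (Fin 2) K) : ℝ := entryNorm A.1 ^ 2 / ‖A.1.det‖

lemma continuous_distortion : Continuous (distortion : GL (Fin 2) K → ℝ) := by
  unfold distortion
  refine ((continuous_entryNorm.comp Units.continuous_val).pow 2).div₀ ?_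
    fun A => (norm_det_pos A).ne'
  exact (Continuous.matrix_det Units.continuous_val).norm

lemma distortion_inv (A : GL (Fin 2) K) : distortion A⁻¹ = distortion A := by
  have h := (norm_det_pos A).ne'
  have h' := (Matrix.GeneralLinearGroup.det A).ne_zero
  have h1 : (A⁻¹ : GL (Fin 2) K).1 = A.1.det⁻¹ • A.1.adjugate := by
    rw [Matrix.coe_units_inv, Matrix.inv_def, Ring.inverse_eq_inv']
  have h2 : ‖(A⁻¹ : GL (Fin 2) K).1.det‖ = ‖A.1.det‖⁻¹ := by
    rw [Matrix.coe_units_inv, Matrix.det_nonsing_inv, Ring.inverse_eq_inv', norm_inv]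
  rw [distortion, h2, h1, entryNorm_smul, entryNorm_adjugate, norm_inv, distortion]
  field_simp

lemma mul_scalar_val (A : GL (Fin 2) K) (u : Kˣ) :
    (A * Matrix.GeneralLinearGroup.scalar (Fin 2) u).1 = (u : K) • A.1 := by
  ext i j
  simp [mul_comm]

lemma distortion_mul_scalar (A : GL (Fin 2) K) (u : Kˣ) :
    distortion (A * .scalar (Fin 2) u) = distortion A := by
  rw [distortion, mul_scalar_val, entryNorm_smul, Matrix.det_smul, distortion, norm_mul,
    Fintype.card_fin, norm_pow]
  have := norm_ne_zero_iff.mpr u.ne_zero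
  have h := (norm_det_pos A).ne'
  field_simp

section Ultrametric

variable [IsUltrametricDist K]

lemma entryNorm_mul_le (A B : Matrix (Fin 2) (Fin 2) K) :
    entryNorm (A * B) ≤ entryNorm A * entryNorm B := by
  rw [entryNorm_le_iff]
  intro i j
  rw [Matrix.mul_apply, Fin.sum_univ_two]
  refine (IsUltrametricDist.norm_add_le_max _ _).trans (max_le ?_ ?_) <;> rw [norm_mul] <;>
    exact mul_le_mul (norm_le_entryNorm ..) (norm_le_entryNorm ..) (norm_nonneg _)
      (entryNorm_nonneg _)

lemma norm_det_le (A : Matrix (Fin 2) (Fin 2) K) : ‖A.det‖ ≤ entryNorm A ^ 2 := by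
  rw [Matrix.det_fin_two, sub_eq_add_neg, sq]
  refine (IsUltrametricDist.norm_add_le_max _ _).trans (max_le ?_ ?_) <;>
    simp only [norm_neg, norm_mul] <;>
    exact mul_le_mul (norm_le_entryNorm ..) (norm_le_entryNorm ..) (norm_nonneg _)
      (entryNorm_nonneg _)

lemma one_le_distortion (A : GL (Fin 2) K) : 1 ≤ distortion A := by
  rw [distortion, one_le_div (norm_det_pos A)]
  exact norm_det_le _

lemma distortion_mul_le (A B : GL (Fin 2) K) :
    distortion (A * B) ≤ distortion A * distortion B := by
  have h1 := norm_det_pos A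
  have h2 := norm_det_pos B
  rw [distortion, distortion, distortion, Units.val_mul, Matrix.det_mul, norm_mul,
    div_mul_div_comm, ← mul_pow]
  have := entryNorm_nonneg (A.1 * B.1)
  gcongr
  exact entryNorm_mul_le _ _

lemma distortion_mul_eq_right {A : GL (Fin 2) K} (hA : distortion A = 1) (B : GL (Fin 2) K) :
    distortion (A * B) = distortion B := by
  apply le_antisymm
  · simpa [hA] using distortion_mul_le A B
  · simpa [hA, distortion_inv] using distortion_mul_le A⁻¹ (A * B)

lemma distortion_mul_eq_left {B : GL (Fin 2) K} (hB : distortion B = 1) (A : GL (Fin 2) K) :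
    distortion (A * B) = distortion A := by
  rw [← distortion_inv, mul_inv_rev, distortion_mul_eq_right (by rwa [distortion_inv]),
    distortion_inv]

omit [IsUltrametricDist K] in
lemma distortion_one : distortion (1 : GL (Fin 2) K) = 1 := by
  simp [distortion, entryNorm]

lemma exists_scalar_entryNorm_eq_one (A : GL (Fin 2) K) :
    ∃ u : Kˣ, entryNorm (A * .scalar (Fin 2) u).1 = 1 := by
  obtain ⟨i, j, hij⟩ := exists_norm_eq_entryNorm A.1
  have h0 : A.1 i j ≠ 0 := by
    rw [← norm_pos_iff, hij]
    have h1 := norm_det_pos A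
    have h2 := norm_det_le A.1
    have h3 := entryNorm_nonneg A.1
    by_contra h4
    have : entryNorm A.1 = 0 := by linarith
    rw [this] at h2
    norm_num at h2
    rw [h2] at h1
    simp at h1
  refine ⟨(Units.mk0 _ h0)⁻¹, ?_⟩
  rw [mul_scalar_val, entryNorm_smul, Units.val_inv_eq_inv_val, Units.val_mk0, norm_inv, ← hij,
    inv_mul_cancel₀ (norm_ne_zero_iff.mpr h0)]

end Ultrametric

end Distortion

section

variable (p : ℕ) [Fact p.Prime] (K : Type*) [NormedField K] [NormedAlgebra ℚ_[p] K]

lemma prime_pos : (0 : ℝ) < p := by exact_mod_cast (Fact.out : p.Prime).pos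

lemma one_lt_prime : (1 : ℝ) < p := by exact_mod_cast (Fact.out : p.Prime).one_lt

lemma norm_unif : ‖(unif p K : K)‖ = (p : ℝ)⁻¹ := by
  have : (unif p K : K) = algebraMap ℚ_[p] K p := rfl
  rw [this, norm_algebraMap', Padic.norm_p]

/-- The diagonal matrix `diag(p ^ j, 1)`. -/
noncomputable def refGL (j : ℤ) : GL (Fin 2) K :=
  Matrix.GeneralLinearGroup.mkOfDetNeZero !![((unif p K ^ j : Kˣ) : K), 0; 0, 1] (by
    rw [Matrix.det_fin_two_of, mul_one, mul_zero, sub_zero]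
    exact Units.ne_zero _)

lemma refGL_val (j : ℤ) : (refGL p K j).1 = !![((unif p K ^ j : Kˣ) : K), 0; 0, 1] := rfl

lemma refVertex_eq (j : ℤ) : refVertex p K j = vertexOf p K (refGL p K j) := rfl

lemma refGL_mul (i j : ℤ) : refGL p K i * refGL p K j = refGL p K (i + j) := by
  ext a b
  rw [Units.val_mul, refGL_val, refGL_val, refGL_val, zpow_add]
  fin_cases a <;> fin_cases b <;> simp

lemma refGL_zero : refGL p K 0 = 1 := by
  ext a b
  rw [refGL_val]
  fin_cases a <;> fin_cases b <;> simp

lemma refGL_inv (j : ℤ) : (refGL p K j)⁻¹ = refGL p K (-j) := by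
  rw [inv_eq_iff_mul_eq_one, refGL_mul, add_neg_cancel, refGL_zero]

lemma norm_unif_zpow (j : ℤ) : ‖((unif p K ^ j : Kˣ) : K)‖ = (p : ℝ) ^ (-j) := by
  rw [Units.val_zpow_eq_zpow_val, norm_zpow, norm_unif, inv_zpow, zpow_neg]

lemma distortion_refGL (n : ℕ) : distortion (refGL p K n) = (p : ℝ) ^ n := by
  have h1 := norm_unif_zpow p K n
  have h2 : (p : ℝ) ^ (-(n : ℤ)) ≤ 1 := zpow_le_one_of_nonpos₀ (one_lt_prime p).le (by omega)
  have h3 : entryNorm (refGL p K n).1 = 1 := by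
    rw [refGL_val]
    simp only [entryNorm, Matrix.of_apply, Matrix.cons_val', Matrix.cons_val_zero,
      Matrix.cons_val_one, Matrix.cons_val_fin_one, h1, norm_zero, norm_one]
    rw [max_eq_right (zero_le_one' ℝ), max_eq_right]
    exact max_le h2 zero_le_one
  rw [distortion, h3, refGL_val, Matrix.det_fin_two_of]
  simp only [mul_one, mul_zero, sub_zero, h1, one_pow]
  rw [zpow_neg, one_div, inv_inv, zpow_natCast]

variable {K}

lemma refGL_mul_val (j : ℤ) (A : GL (Fin 2) K) : (refGL p K j * A).1 =
    !![((unif p K ^ j : Kˣ) : K) * A.1 0 0, ((unif p K ^ j : Kˣ) : K) * A.1 0 1;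
      A.1 1 0, A.1 1 1] := by
  ext a b
  rw [Units.val_mul, Matrix.mul_apply, Fin.sum_univ_two, refGL_val]
  fin_cases a <;> fin_cases b <;> simp

lemma mul_refGL_val (A : GL (Fin 2) K) (j : ℤ) : (A * refGL p K j).1 =
    !![A.1 0 0 * ((unif p K ^ j : Kˣ) : K), A.1 0 1;
      A.1 1 0 * ((unif p K ^ j : Kˣ) : K), A.1 1 1] := by
  ext a b
  rw [Units.val_mul, Matrix.mul_apply, Fin.sum_univ_two, refGL_val]
  fin_cases a <;> fin_cases b <;> simp

/-- Elements of `maxCompact` are the classes of matrices of distortion `1`. -/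
lemma mk_mem_maxCompact_iff {A : GL (Fin 2) K} :
    Matrix.ProjGenLinGroup.mk A ∈ maxCompact p K ↔ distortion A = 1 := by
  have := isUltrametricDist p K
  constructor
  · rintro ⟨-, ⟨B, rfl⟩, hB⟩
    rw [Matrix.ProjGenLinGroup.mk_eq_mk_iff] at hB
    obtain ⟨u, rfl⟩ := hB
    rw [distortion_mul_scalar]
    set A := Matrix.GeneralLinearGroup.map (n := Fin 2) (ringOfIntegers p K).subtype B
    have hle : ∀ C : GL (Fin 2) (ringOfIntegers p K),
        entryNorm (Matrix.GeneralLinearGroup.map (ringOfIntegers p K).subtype C).1 ≤ 1 := by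
      intro C
      rw [entryNorm_le_iff]
      exact fun i j => (C.1 i j).2
    have h1 : entryNorm A.1 ≤ 1 := hle B
    have h2 : entryNorm (A⁻¹).1 ≤ 1 := by
      rw [← map_inv]
      exact hle _
    have h3 : ‖A.1.det‖ * ‖(A⁻¹).1.det‖ = 1 := by
      rw [← norm_mul, ← Matrix.det_mul, ← Units.val_mul, mul_inv_cancel, Units.val_one,
        Matrix.det_one, norm_one]
    have h4 := norm_det_le A.1
    have h5 := norm_det_le (A⁻¹).1
    have h6 := entryNorm_nonneg A.1
    have h7 := entryNorm_nonneg (A⁻¹).1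
    have h8 : ‖(A⁻¹).1.det‖ ≤ 1 := h5.trans (pow_le_one₀ h7 h2)
    have h9 : 1 ≤ ‖A.1.det‖ := by
      by_contra! h
      have := norm_det_pos A
      nlinarith [norm_det_pos A⁻¹]
    apply le_antisymm _ (one_le_distortion A)
    rw [distortion, div_le_one (norm_det_pos A)]
    exact (pow_le_one₀ h6 h1).trans h9
  · intro hA
    obtain ⟨u, hu⟩ := exists_scalar_entryNorm_eq_one A
    have hA' : distortion (A * .scalar (Fin 2) u) = 1 := by rw [distortion_mul_scalar, hA]
    have hmk : Matrix.ProjGenLinGroup.mk A =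
        Matrix.ProjGenLinGroup.mk (A * .scalar (Fin 2) u) :=
      Matrix.ProjGenLinGroup.mk_eq_mk_iff.mpr ⟨u, rfl⟩
    rw [hmk]
    generalize A * .scalar (Fin 2) u = A at hu hA'
    have hdet : ‖A.1.det‖ = 1 := by
      rw [distortion, hu, one_pow, div_eq_one_iff_eq (norm_det_pos A).ne'] at hA'
      exact hA'.symm
    let B : Matrix (Fin 2) (Fin 2) (ringOfIntegers p K) :=
      fun i j => ⟨A.1 i j, (norm_le_entryNorm A.1 i j).trans hu.le⟩
    have hBA : B.map (ringOfIntegers p K).subtype = A.1 := rfl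
    have hBdet : ((B.det : ringOfIntegers p K) : K) = A.1.det := by
      have := RingHom.map_det (ringOfIntegers p K).subtype B
      exact this
    have hunit : IsUnit B.det := by
      have hinv : ‖(A.1.det)⁻¹‖ ≤ 1 := by rw [norm_inv, hdet, inv_one]
      refine IsUnit.of_mul_eq_one ⟨(A.1.det)⁻¹, hinv⟩ (Subtype.ext ?_)
      change (B.det : K) * (A.1.det)⁻¹ = 1
      rw [hBdet]
      exact mul_inv_cancel₀ (norm_ne_zero_iff.mp (by rw [hdet]; exact one_ne_zero))
    refine ⟨A, ⟨Matrix.GeneralLinearGroup.mk'' B hunit, ?_⟩, rfl⟩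
    ext i j
    rfl

lemma vertexOf_eq_iff {A B : GL (Fin 2) K} :
    vertexOf p K A = vertexOf p K B ↔ distortion (A⁻¹ * B) = 1 := by
  rw [vertexOf, vertexOf, QuotientGroup.eq, ← map_inv, ← map_mul, mk_mem_maxCompact_iff]

lemma vertexOf_mul_scalar (A : GL (Fin 2) K) (u : Kˣ) :
    vertexOf p K (A * .scalar (Fin 2) u) = vertexOf p K A := by
  rw [vertexOf, vertexOf, map_mul, Matrix.ProjGenLinGroup.mk_scalar, mul_one]

lemma exists_vertexOf_eq (v : Vertex p K) : ∃ A, vertexOf p K A = v := by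
  obtain ⟨g, rfl⟩ := QuotientGroup.mk_surjective v
  obtain ⟨A, rfl⟩ := Matrix.ProjGenLinGroup.mk_surjective g
  exact ⟨A, rfl⟩

lemma mk_smul_vertexOf (A B : GL (Fin 2) K) :
    Matrix.ProjGenLinGroup.mk A • vertexOf p K B = vertexOf p K (A * B) := rfl

omit [NormedAlgebra ℚ_[p] K] in
/-- The valuation of the base field, in multiplicative form: `K` takes no absolute values outside
the powers of `p`. -/
lemma exists_norm_eq_zpow (hK : ∀ x : K, ∃ y : ℚ_[p], ‖x‖ = ‖y‖) {x : K} (hx : x ≠ 0) :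
    ∃ n : ℤ, ‖x‖ = (p : ℝ) ^ (-n) := by
  obtain ⟨y, hy⟩ := hK x
  have hy0 : y ≠ 0 := by
    rw [← norm_ne_zero_iff, ← hy]
    exact norm_ne_zero_iff.mpr hx
  exact ⟨y.valuation, by rw [hy, Padic.norm_eq_zpow_neg_valuation hy0]⟩

/-- The Weyl element, which exchanges the coordinates. -/
noncomputable def weyl (K : Type*) [NormedField K] : GL (Fin 2) K :=
  Matrix.GeneralLinearGroup.mkOfDetNeZero !![0, 1; 1, 0] (by simp)

omit [Fact p.Prime] [NormedAlgebra ℚ_[p] K] in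
lemma distortion_weyl : distortion (weyl K) = 1 := by
  have : (weyl K).1 = !![0, 1; 1, 0] := rfl
  rw [distortion, this]
  simp [entryNorm, Matrix.det_fin_two_of]

/-- The Cartan decomposition of `GL₂(K)`. -/
lemma exists_cartan (hK : ∀ x : K, ∃ y : ℚ_[p], ‖x‖ = ‖y‖) (A : GL (Fin 2) K) :
    ∃ (k : GL (Fin 2) K) (n : ℕ), distortion k = 1 ∧
      distortion ((k * refGL p K n)⁻¹ * A) = 1 := by
  have := isUltrametricDist p K
  -- It suffices to treat matrices whose lower right entry is the largest one.
  have core : ∀ A : GL (Fin 2) K, ‖A.1 1 1‖ = entryNorm A.1 → ∃ (k : GL (Fin 2) K) (n : ℕ),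
      distortion k = 1 ∧ distortion ((k * refGL p K n)⁻¹ * A) = 1 := by
    intro A hA
    have hdetpos := norm_det_pos A
    have hdetle := norm_det_le A.1
    set a := A.1 0 0
    set b := A.1 0 1
    set c := A.1 1 0
    set d := A.1 1 1
    have hd0 : d ≠ 0 := by
      rintro h0
      rw [← hA, h0] at hdetle
      simp at hdetle
      rw [hdetle] at hdetpos
      simp at hdetpos
    have hdn : 0 < ‖d‖ := norm_pos_iff.mpr hd0
    have hdet0 : A.1.det ≠ 0 := norm_pos_iff.mp hdetpos
    obtain ⟨m, hm⟩ := exists_norm_eq_zpow p hK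
      (x := A.1.det / d ^ 2) (div_ne_zero hdet0 (pow_ne_zero 2 hd0))
    have hm0 : 0 ≤ m := by
      have h1 : ‖A.1.det / d ^ 2‖ ≤ 1 := by
        rw [norm_div, norm_pow, hA]
        refine div_le_one_of_le₀ hdetle (sq_nonneg _)
      rw [hm] at h1
      by_contra! hneg
      exact absurd (one_lt_zpow₀ (one_lt_prime p) (show 0 < -m by omega)) (not_lt.mpr h1)
    obtain ⟨n, rfl⟩ := Int.eq_ofNat_of_zero_le hm0
    let k : GL (Fin 2) K :=
      Matrix.GeneralLinearGroup.mkOfDetNeZero !![1, b / d; 0, 1] (by simp)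
    have hk : k.1 = !![1, b / d; 0, 1] := rfl
    have hbd : ‖b / d‖ ≤ 1 := by
      rw [norm_div, hA]
      exact div_le_one_of_le₀ (norm_le_entryNorm A.1 0 1) (entryNorm_nonneg _)
    refine ⟨k, n, ?_, ?_⟩
    · rw [distortion, hk]
      rw [norm_div] at hbd
      simp [entryNorm, Matrix.det_fin_two_of, max_eq_left hbd]
    · let L : GL (Fin 2) K := Matrix.GeneralLinearGroup.mkOfDetNeZero
        !![A.1.det / d * ((unif p K ^ (-(n : ℤ)) : Kˣ) : K), 0; c, d] (by
          rw [Matrix.det_fin_two_of]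
          simp [hdet0, hd0])
      have hL : L.1 = !![A.1.det / d * ((unif p K ^ (-(n : ℤ)) : Kˣ) : K), 0; c, d] := rfl
      have hkL : (k * refGL p K n)⁻¹ * A = L := by
        rw [inv_mul_eq_iff_eq_mul]
        apply Units.ext
        have hu : ((unif p K ^ (n : ℤ) : Kˣ) : K) * ((unif p K ^ (-(n : ℤ)) : Kˣ) : K) = 1 := by
          rw [← Units.val_mul, ← zpow_add, add_neg_cancel, zpow_zero, Units.val_one]
        rw [Units.val_mul, Units.val_mul, hk, hL, refGL_val]
        have hdet : A.1.det = a * d - b * c := Matrix.det_fin_two A.1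
        ext i j
        fin_cases i <;> fin_cases j
        · simp [Matrix.mul_apply, Fin.sum_univ_two, -zpow_natCast, -zpow_neg,
            -Units.val_zpow_eq_zpow_val]
          change a = _
          have : ((unif p K ^ (n : ℤ) : Kˣ) : K) * (A.1.det / d *
              ((unif p K ^ (-(n : ℤ)) : Kˣ) : K)) = A.1.det / d := by
            linear_combination A.1.det / d * hu
          rw [this, hdet]
          field_simp
          ring
        · simp [Matrix.mul_apply, Fin.sum_univ_two]
          change b = _
          field_simp
        · simp [Matrix.mul_apply, Fin.sum_univ_two]
          rfl
        · simp [Matrix.mul_apply, Fin.sum_univ_two]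
          rfl
      have hnorm : ‖A.1.det / d * ((unif p K ^ (-(n : ℤ)) : Kˣ) : K)‖ = ‖d‖ := by
        have h1 : A.1.det / d = A.1.det / d ^ 2 * d := by field_simp
        have h2 : (p : ℝ) ^ (n : ℤ) ≠ 0 := (zpow_pos (prime_pos p) _).ne'
        rw [h1, norm_mul, norm_mul, hm, norm_unif_zpow, neg_neg, zpow_neg]
        field_simp
      have hcd : ‖c‖ ≤ ‖d‖ := by
        rw [hA]
        exact norm_le_entryNorm A.1 1 0
      rw [hkL, distortion, hL, Matrix.det_fin_two_of, zero_mul, sub_zero, norm_mul, hnorm]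
      have : entryNorm !![A.1.det / d * ((unif p K ^ (-(n : ℤ)) : Kˣ) : K), 0; c, d] = ‖d‖ := by
        simp only [entryNorm, Matrix.of_apply, Matrix.cons_val', Matrix.cons_val_zero,
          Matrix.cons_val_one, Matrix.cons_val_fin_one, hnorm, norm_zero]
        rw [max_eq_left hdn.le, max_eq_right hcd, max_self]
      rw [this, sq, div_self (mul_pos hdn hdn).ne']
  have hw : (weyl K).1 = !![0, 1; 1, 0] := rfl
  have row : ∀ A : GL (Fin 2) K, entryNorm (weyl K * A).1 = entryNorm A.1 := by
    intro A
    rw [Units.val_mul, hw]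
    simp [entryNorm, Matrix.mul_apply, Fin.sum_univ_two, max_comm]
  have col : ∀ A : GL (Fin 2) K, entryNorm (A * weyl K).1 = entryNorm A.1 := by
    intro A
    rw [Units.val_mul, hw]
    simp [entryNorm, Matrix.mul_apply, Fin.sum_univ_two, max_comm]
  have core' : ∀ A : GL (Fin 2) K, (∃ i, ‖A.1 i 1‖ = entryNorm A.1) →
      ∃ (k : GL (Fin 2) K) (n : ℕ),
      distortion k = 1 ∧ distortion ((k * refGL p K n)⁻¹ * A) = 1 := by
    rintro A ⟨i, hi⟩
    fin_cases i
    · obtain ⟨k, n, hk, h⟩ := core (weyl K * A) (by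
        rw [row, ← hi, Units.val_mul, hw]
        simp [Matrix.mul_apply, Fin.sum_univ_two])
      refine ⟨(weyl K)⁻¹ * k, n, ?_, ?_⟩
      · rw [distortion_mul_eq_right (by rw [distortion_inv, distortion_weyl]), hk]
      · rw [← h]
        congr 1
        group
    · exact core A hi
  obtain ⟨i, j, hij⟩ := exists_norm_eq_entryNorm A.1
  fin_cases j
  · obtain ⟨k, n, hk, h⟩ := core' (A * weyl K) ⟨i, by
      rw [col, ← hij, Units.val_mul, hw]
      simp [Matrix.mul_apply, Fin.sum_univ_two]⟩
    refine ⟨k, n, hk, ?_⟩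
    rwa [← mul_assoc, distortion_mul_eq_left distortion_weyl] at h
  · exact core' A ⟨i, hij⟩

end

end BruhatTits

/-! ### The metric of the Bruhat-Tits tree -/

namespace BruhatTits

variable (p : ℕ) [Fact p.Prime] {K : Type*} [NormedField K] [NormedAlgebra ℚ_[p] K]

lemma smul_lattice_subset_iff (c : K) (A B : GL (Fin 2) K) :
    c • lattice p A ⊆ lattice p B ↔ entryNorm (c • (B⁻¹ * A).1) ≤ 1 := by
  have := isUltrametricDist p K
  rw [entryNorm_le_iff]
  have hB : B.1 * (B⁻¹ * A).1 = A.1 := by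
    rw [← Units.val_mul, mul_inv_cancel_left]
  have hB' : (B⁻¹).1 * B.1 = 1 := by
    rw [← Units.val_mul, inv_mul_cancel, Units.val_one]
  constructor
  · intro h i j
    have hj : A.1.mulVec (Pi.single j 1) ∈ lattice p A := by
      refine ⟨Pi.single j 1, fun i => ?_, rfl⟩
      rcases eq_or_ne i j with rfl | hne
      · rw [Pi.single_eq_same]
        exact one_mem _
      · rw [Pi.single_eq_of_ne hne]
        exact zero_mem _
    obtain ⟨x, hx, hxe⟩ := h (Set.smul_mem_smul_set hj)
    have hxe' : x = c • (B⁻¹ * A).1.mulVec (Pi.single j 1) := by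
      have := congrArg ((B⁻¹).1.mulVec) hxe
      simp only [Matrix.mulVec_mulVec, hB', Matrix.one_mulVec, Matrix.mulVec_smul] at this
      rw [this, ← Units.val_mul]
    have := hx i
    rw [hxe'] at this
    have h2 : ‖(c • (B⁻¹ * A).1.mulVec (Pi.single j 1)) i‖ ≤ 1 := this
    simpa using h2
  · rintro h - ⟨-, ⟨x, hx, rfl⟩, rfl⟩
    refine ⟨(c • (B⁻¹ * A).1).mulVec x, fun i => ?_, ?_⟩
    · rw [Matrix.mulVec, dotProduct]
      exact sum_mem fun j _ => mul_mem (h i j) (hx j)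
    · beta_reduce
      rw [Matrix.smul_mulVec, Matrix.mulVec_smul, Matrix.mulVec_mulVec, hB]

lemma lattice_subset_iff (A B : GL (Fin 2) K) :
    lattice p A ⊆ lattice p B ↔ entryNorm (B⁻¹ * A).1 ≤ 1 := by
  simpa using smul_lattice_subset_iff p 1 A B

lemma subset_smul_lattice_iff (c : Kˣ) (A B : GL (Fin 2) K) :
    lattice p A ⊆ (c : K) • lattice p B ↔ entryNorm (((c⁻¹ : Kˣ) : K) • (B⁻¹ * A).1) ≤ 1 := by
  rw [← smul_lattice_subset_iff p]
  exact Set.subset_smul_set_iff (a := c)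

lemma entryNorm_inv (A : GL (Fin 2) K) : entryNorm (A⁻¹).1 = entryNorm A.1 / ‖A.1.det‖ := by
  rw [Matrix.coe_units_inv, Matrix.inv_def, Ring.inverse_eq_inv', entryNorm_smul,
    entryNorm_adjugate, norm_inv]
  ring

variable (hK : ∀ x : K, ∃ y : ℚ_[p], ‖x‖ = ‖y‖)
include hK

omit [NormedAlgebra ℚ_[p] K] in
lemma norm_le_inv_prime_of_lt_one {x : K} (hx : ‖x‖ < 1) : ‖x‖ ≤ (p : ℝ)⁻¹ := by
  rcases eq_or_ne x 0 with rfl | h0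
  · simp
  obtain ⟨n, hn⟩ := exists_norm_eq_zpow p hK h0
  rw [hn] at hx ⊢
  have : 0 < n := by
    by_contra! h
    exact absurd hx (not_lt.mpr (one_le_zpow₀ (one_lt_prime p).le (by omega)))
  rw [← zpow_neg_one]
  exact zpow_le_zpow_right₀ (one_lt_prime p).le (by omega)

lemma lattice_chain_iff (A B : GL (Fin 2) K) :
    ((unif p K : K) • lattice p A ⊂ lattice p B ∧ lattice p B ⊂ lattice p A) ↔
      entryNorm (A⁻¹ * B).1 = 1 ∧ ‖(A⁻¹ * B).1.det‖ = (p : ℝ)⁻¹ := by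
  have hp := prime_pos p
  have hp1 := one_lt_prime p
  rw [ssubset_iff_subset_not_subset, ssubset_iff_subset_not_subset, smul_lattice_subset_iff,
    subset_smul_lattice_iff, lattice_subset_iff, lattice_subset_iff]
  have hinv : B⁻¹ * A = (A⁻¹ * B)⁻¹ := by group
  rw [hinv]
  generalize A⁻¹ * B = C
  rw [entryNorm_smul, entryNorm_smul, entryNorm_inv, Units.val_inv_eq_inv_val, norm_inv, norm_unif,
    inv_inv]
  have hd := norm_det_pos C
  constructor
  · rintro ⟨⟨h1, h2⟩, h3, h4⟩
    obtain ⟨i, j, hij⟩ := exists_norm_eq_entryNorm C.1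
    have hC : entryNorm C.1 = 1 := by
      refine le_antisymm h3 ?_
      by_contra! h
      refine h2 ?_
      rw [← hij] at h ⊢
      have := norm_le_inv_prime_of_lt_one p hK h
      calc (p : ℝ) * ‖C.1 i j‖ ≤ p * (p : ℝ)⁻¹ := by gcongr
        _ = 1 := mul_inv_cancel₀ hp.ne'
    refine ⟨hC, ?_⟩
    rw [hC, not_le, one_lt_div hd] at h4
    refine le_antisymm (norm_le_inv_prime_of_lt_one p hK h4) ?_
    rw [hC, mul_one_div] at h1
    exact (div_le_one hd).mp h1
  · rintro ⟨h1, h2⟩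
    rw [h1, h2]
    refine ⟨⟨?_, ?_⟩, le_rfl, ?_⟩
    · rw [mul_one_div, div_self (inv_pos.mpr hp).ne']
    · rw [mul_one, not_le]
      exact hp1
    · rw [one_div, inv_inv, not_le]
      exact hp1

omit hK in
lemma distortion_congr {A A' B B' : GL (Fin 2) K} (hA : vertexOf p K A = vertexOf p K A')
    (hB : vertexOf p K B = vertexOf p K B') :
    distortion (A⁻¹ * B) = distortion (A'⁻¹ * B') := by
  have := isUltrametricDist p K
  rw [vertexOf_eq_iff] at hA hB
  have h : A'⁻¹ * B' = (A⁻¹ * A')⁻¹ * ((A⁻¹ * B) * (B⁻¹ * B')) := by group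
  rw [h, distortion_mul_eq_right (A := (A⁻¹ * A')⁻¹) (by rwa [distortion_inv]),
    distortion_mul_eq_left hB]

lemma tree_adj_iff (A B : GL (Fin 2) K) :
    (tree p K).Adj (vertexOf p K A) (vertexOf p K B) ↔ distortion (A⁻¹ * B) = p := by
  have := isUltrametricDist p K
  have hp1 := one_lt_prime p
  rw [tree, SimpleGraph.fromRel_adj]
  constructor
  · rintro ⟨-, ⟨A', B', hA, hB, h⟩ | ⟨B', A', hB, hA, h⟩⟩ <;>
      rw [lattice_chain_iff p hK] at h
    · rw [← distortion_congr p hA hB, distortion, h.1, h.2]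
      simp
    · rw [← distortion_congr p hA hB, ← distortion_inv, mul_inv_rev, inv_inv, distortion, h.1, h.2]
      simp
  · intro h
    refine ⟨fun heq => ?_, .inl ?_⟩
    · rw [vertexOf_eq_iff] at heq
      rw [h] at heq
      exact hp1.ne' heq
    · obtain ⟨u, hu⟩ := exists_scalar_entryNorm_eq_one (A⁻¹ * B)
      have h' := h
      rw [← distortion_mul_scalar _ u, distortion, hu, one_pow, one_div] at h
      refine ⟨A, B * .scalar (Fin 2) u, rfl, ?_, ?_⟩
      · rw [vertexOf_eq_iff, mul_inv_rev, inv_mul_cancel_right, distortion_inv,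
          ← one_mul (Matrix.GeneralLinearGroup.scalar (Fin 2) u), distortion_mul_scalar,
          distortion_one]
      · rw [lattice_chain_iff p hK, ← mul_assoc]
        exact ⟨hu, by rw [← h, inv_inv]⟩

lemma exists_walk_length_eq (A : GL (Fin 2) K) (n : ℕ) :
    ∃ q : (tree p K).Walk (vertexOf p K A) (vertexOf p K (A * refGL p K n)), q.length = n := by
  induction n with
  | zero =>
    have h : vertexOf p K A = vertexOf p K (A * refGL p K (0 : ℕ)) := by
      rw [Nat.cast_zero, refGL_zero, mul_one]
    exact ⟨SimpleGraph.Walk.nil.copy rfl h, by simp⟩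
  | succ n ih =>
    obtain ⟨q, hq⟩ := ih
    have hadj : (tree p K).Adj (vertexOf p K (A * refGL p K n))
        (vertexOf p K (A * refGL p K (n + 1 : ℕ))) := by
      rw [tree_adj_iff p hK]
      have : (A * refGL p K n)⁻¹ * (A * refGL p K (n + 1 : ℕ)) = refGL p K (1 : ℕ) := by
        rw [mul_inv_rev, mul_assoc, inv_mul_cancel_left, refGL_inv, refGL_mul]
        congr 1
        push_cast
        ring
      rw [this, distortion_refGL, pow_one]
    exact ⟨q.concat hadj, by simp [hq]⟩

/-- Relative to a suitable frame, any two vertices lie on the reference geodesic. -/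
lemma exists_frame (x y : Vertex p K) :
    ∃ (A : GL (Fin 2) K) (n : ℕ), vertexOf p K A = x ∧ vertexOf p K (A * refGL p K n) = y := by
  have := isUltrametricDist p K
  obtain ⟨A, rfl⟩ := exists_vertexOf_eq p x
  obtain ⟨B, rfl⟩ := exists_vertexOf_eq p y
  obtain ⟨k, n, hk, h⟩ := exists_cartan p hK (A⁻¹ * B)
  refine ⟨A * k, n, ?_, ?_⟩ <;> rw [vertexOf_eq_iff]
  · rwa [mul_inv_rev, inv_mul_cancel_right, distortion_inv]
  · rw [← h]
    congr 1
    group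

lemma tree_connected : (tree p K).Connected := by
  rw [SimpleGraph.connected_iff]
  refine ⟨fun x y => ?_, ⟨refVertex p K 0⟩⟩
  obtain ⟨A, n, rfl, rfl⟩ := exists_frame p hK x y
  obtain ⟨q, -⟩ := exists_walk_length_eq p hK A n
  exact ⟨q⟩

/-- The distance of the tree in terms of matrices. -/
lemma distortion_eq_pow_dist (A B : GL (Fin 2) K) :
    distortion (A⁻¹ * B) = (p : ℝ) ^ (tree p K).dist (vertexOf p K A) (vertexOf p K B) := by
  have := isUltrametricDist p K
  have lower : ∀ {x y : Vertex p K} (q : (tree p K).Walk x y) (A B : GL (Fin 2) K),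
      vertexOf p K A = x → vertexOf p K B = y → distortion (A⁻¹ * B) ≤ (p : ℝ) ^ q.length := by
    intro x y q
    induction q with
    | nil =>
      rintro A B rfl h
      rw [eq_comm, vertexOf_eq_iff] at h
      rw [h]
      simp
    | cons hadj q ih =>
      rename_i z _
      rintro A B rfl rfl
      obtain ⟨D, rfl⟩ := exists_vertexOf_eq p z
      rw [tree_adj_iff p hK] at hadj
      have h1 := ih D B rfl rfl
      have h2 : A⁻¹ * B = (A⁻¹ * D) * (D⁻¹ * B) := by group
      rw [h2, SimpleGraph.Walk.length_cons, pow_succ']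
      refine (distortion_mul_le _ _).trans ?_
      rw [hadj]
      have := prime_pos p
      gcongr
  obtain ⟨q, hq⟩ := (tree_connected p hK).exists_walk_length_eq_dist
    (vertexOf p K A) (vertexOf p K B)
  refine le_antisymm (hq ▸ lower q A B rfl rfl) ?_
  obtain ⟨D, n, hA, hB⟩ := exists_frame p hK (vertexOf p K A) (vertexOf p K B)
  obtain ⟨q', hq'⟩ := exists_walk_length_eq p hK D n
  rw [← distortion_congr p hA hB, inv_mul_cancel_left, distortion_refGL, ← hA, ← hB]
  refine pow_le_pow_right₀ (one_lt_prime p).le ?_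
  conv_rhs => rw [← hq']
  exact SimpleGraph.dist_le q'

lemma dist_eq_iff (A B : GL (Fin 2) K) (n : ℕ) :
    (tree p K).dist (vertexOf p K A) (vertexOf p K B) = n ↔ distortion (A⁻¹ * B) = (p : ℝ) ^ n := by
  rw [distortion_eq_pow_dist p hK]
  exact (pow_right_injective₀ (prime_pos p) (one_lt_prime p).ne').eq_iff.symm

lemma dist_smul (g : PGL(2, K)) (x y : Vertex p K) :
    (tree p K).dist (g • x) (g • y) = (tree p K).dist x y := by
  obtain ⟨U, rfl⟩ := Matrix.ProjGenLinGroup.mk_surjective g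
  obtain ⟨A, rfl⟩ := exists_vertexOf_eq p x
  obtain ⟨B, rfl⟩ := exists_vertexOf_eq p y
  rw [mk_smul_vertexOf, mk_smul_vertexOf, dist_eq_iff p hK, mul_inv_rev, mul_assoc,
    inv_mul_cancel_left, ← dist_eq_iff p hK]

/-- The Bruhat-Tits tree is a tree. For a root `x` and a vertex `v` in the position of
`diag(p ^ n, 1)`, a neighbour of `v` is of the form `diag(p ^ n, 1) * k * diag(p, 1)` with `k` in
`GL₂(𝒪)`; it is further away from `x` unless the lower right entry of `k` is divisible by `p`,
and then, for `n ≥ 1`, it is `diag(p ^ (n - 1), 1)`. -/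
lemma tree_uniqueDescent : (tree p K).UniqueDescent := by
  have := isUltrametricDist p K
  have hp := prime_pos p
  have hp1 := one_lt_prime p
  refine ⟨tree_connected p hK, fun x v => ?_⟩
  obtain ⟨D, n, rfl, rfl⟩ := exists_frame p hK x v
  have hdist : ∀ m : ℕ, (tree p K).dist (vertexOf p K D) (vertexOf p K (D * refGL p K m)) = m := by
    intro m
    rw [dist_eq_iff p hK, inv_mul_cancel_left, distortion_refGL]
  refine ⟨vertexOf p K (D * refGL p K (n - 1)), fun w hw => ?_⟩
  rcases Nat.eq_zero_or_pos n with rfl | hn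
  · left
    rw [hdist, SimpleGraph.dist_eq_one_iff_adj]
    simpa [refGL_zero] using hw
  obtain ⟨B, rfl⟩ := exists_vertexOf_eq p w
  rw [tree_adj_iff p hK] at hw
  obtain ⟨k, m, hk, hB⟩ := exists_cartan p hK ((D * refGL p K n)⁻¹ * B)
  obtain rfl : m = 1 := by
    have h : (D * refGL p K n)⁻¹ * B =
        (k * refGL p K m) * ((k * refGL p K m)⁻¹ * ((D * refGL p K n)⁻¹ * B)) := by group
    rw [h, distortion_mul_eq_left hB, distortion_mul_eq_right hk, distortion_refGL] at hw
    exact pow_right_injective₀ hp hp1.ne' (by simpa using hw)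
  obtain ⟨u, hu⟩ := exists_scalar_entryNorm_eq_one k
  have hBv : vertexOf p K (D * refGL p K n * (k * .scalar (Fin 2) u) * refGL p K (1 : ℕ)) =
      vertexOf p K B := by
    have hc : D * refGL p K n * (k * .scalar (Fin 2) u) * refGL p K (1 : ℕ) =
        D * refGL p K n * k * refGL p K (1 : ℕ) * .scalar (Fin 2) u := by
      simp only [mul_assoc]
      congr 3
      ext i j
      simp [mul_comm]
    rw [hc, vertexOf_mul_scalar, vertexOf_eq_iff, ← hB]
    congr 1
    group
  have hk' : distortion (k * .scalar (Fin 2) u) = 1 := by rw [distortion_mul_scalar, hk]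
  generalize k * .scalar (Fin 2) u = k at hu hBv hk'
  have hdet : ‖k.1.det‖ = 1 := by
    rw [distortion, hu, one_pow, div_eq_one_iff_eq (norm_det_pos k).ne'] at hk'
    exact hk'.symm
  have hent : ∀ m : ℤ, (refGL p K m * k * refGL p K (1 : ℕ)).1 =
      !![((unif p K ^ (m + 1) : Kˣ) : K) * k.1 0 0, ((unif p K ^ m : Kˣ) : K) * k.1 0 1;
        ((unif p K ^ (1 : ℤ) : Kˣ) : K) * k.1 1 0, k.1 1 1] := by
    intro m
    rw [mul_refGL_val, refGL_mul_val, zpow_add]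
    ext i j
    fin_cases i <;> fin_cases j <;> simp <;> ring
  have hentdet : ∀ m : ℤ, ‖(refGL p K m * k * refGL p K (1 : ℕ)).1.det‖ = (p : ℝ) ^ (-(m + 1)) := by
    intro m
    rw [Units.val_mul, Units.val_mul, Matrix.det_mul, Matrix.det_mul, norm_mul, norm_mul, hdet,
      refGL_val, refGL_val, Matrix.det_fin_two_of, Matrix.det_fin_two_of]
    simp only [mul_one, mul_zero, sub_zero, norm_unif_zpow]
    rw [← zpow_add₀ hp.ne']
    congr 1
    push_cast
    ring
  have hle : ∀ i j, ‖k.1 i j‖ ≤ 1 := fun i j => (norm_le_entryNorm _ i j).trans hu.le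
  rw [← hBv]
  by_cases hd : ‖k.1 1 1‖ = 1
  · left
    rw [hdist, dist_eq_iff p hK]
    have h1 : D⁻¹ * (D * refGL p K n * k * refGL p K (1 : ℕ)) =
        refGL p K n * k * refGL p K (1 : ℕ) := by group
    have h2 : entryNorm (refGL p K n * k * refGL p K (1 : ℕ)).1 = 1 := by
      have hz : ∀ m : ℤ, 0 ≤ m → ‖((unif p K ^ m : Kˣ) : K)‖ ≤ 1 := by
        intro m hm
        rw [norm_unif_zpow]
        exact zpow_le_one_of_nonpos₀ hp1.le (by omega)
      apply le_antisymm
      · rw [hent, entryNorm_le_iff]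
        intro i j
        fin_cases i <;> fin_cases j
        · exact (norm_mul_le _ _).trans (mul_le_one₀ (hz _ (by omega)) (norm_nonneg _) (hle 0 0))
        · exact (norm_mul_le _ _).trans (mul_le_one₀ (hz _ (by omega)) (norm_nonneg _) (hle 0 1))
        · exact (norm_mul_le _ _).trans (mul_le_one₀ (hz _ (by omega)) (norm_nonneg _) (hle 1 0))
        · exact hle 1 1
      · have := norm_le_entryNorm (refGL p K n * k * refGL p K (1 : ℕ)).1 1 1
        rw [hent] at this ⊢
        exact hd.ge.trans this
    rw [h1, distortion, h2, hentdet, one_pow, zpow_neg, one_div, inv_inv]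
    exact_mod_cast rfl
  · right
    have hd' : ‖k.1 1 1‖ ≤ (p : ℝ)⁻¹ :=
      norm_le_inv_prime_of_lt_one p hK ((hle 1 1).lt_of_ne hd)
    have hw : vertexOf p K (D * refGL p K n * k * refGL p K (1 : ℕ)) =
        vertexOf p K (D * refGL p K (n - 1)) := by
      rw [eq_comm, vertexOf_eq_iff]
      have h1 : (D * refGL p K (n - 1))⁻¹ * (D * refGL p K n * k * refGL p K (1 : ℕ)) =
          refGL p K 1 * k * refGL p K (1 : ℕ) := by
        have h2 : refGL p K n = refGL p K (n - 1) * refGL p K 1 := by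
          rw [refGL_mul, sub_add_cancel]
        rw [h2]
        group
      rw [h1]
      refine le_antisymm ?_ (one_le_distortion _)
      have h3 : entryNorm (refGL p K 1 * k * refGL p K (1 : ℕ)).1 ≤ (p : ℝ)⁻¹ := by
        have hz : ∀ m : ℤ, 1 ≤ m → ‖((unif p K ^ m : Kˣ) : K)‖ ≤ (p : ℝ)⁻¹ := by
          intro m hm
          rw [norm_unif_zpow, ← zpow_neg_one]
          exact zpow_le_zpow_right₀ hp1.le (by omega)
        have hz' : ∀ (m : ℤ) (i j : Fin 2), 1 ≤ m →
            ‖((unif p K ^ m : Kˣ) : K) * k.1 i j‖ ≤ (p : ℝ)⁻¹ := by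
          intro m i j hm
          rw [norm_mul]
          simpa using mul_le_mul (hz m hm) (hle i j) (norm_nonneg _) (inv_pos.mpr hp).le
        rw [hent, entryNorm_le_iff]
        intro i j
        fin_cases i <;> fin_cases j
        · exact hz' _ 0 0 (by omega)
        · exact hz' _ 0 1 le_rfl
        · exact hz' _ 1 0 le_rfl
        · exact hd'
      rw [distortion, div_le_one (norm_det_pos _), hentdet]
      calc _ ≤ ((p : ℝ)⁻¹) ^ 2 := by
            have := entryNorm_nonneg (refGL p K 1 * k * refGL p K (1 : ℕ)).1
            gcongr
        _ = _ := by
          rw [zpow_neg, inv_pow]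
          norm_cast
    refine ⟨hw, ?_⟩
    rw [hw, hdist]
    obtain ⟨m, rfl⟩ : ∃ m, n = m + 1 := ⟨n - 1, by omega⟩
    have : ((m + 1 : ℕ) : ℤ) - 1 = (m : ℕ) := by push_cast; ring
    rw [this, hdist]

/-! ### Rays and limit sets -/

lemma dist_ray (g : PGL(2, K)) (i : ℤ) (n : ℕ) :
    (tree p K).dist (g • refVertex p K (-i)) (g • refVertex p K (-(i + n))) = n := by
  rw [dist_smul p hK, refVertex_eq, refVertex_eq, dist_eq_iff p hK, refGL_inv, refGL_mul,
    ← distortion_inv, refGL_inv, ← distortion_refGL p K n]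
  congr 2
  ring

lemma adj_ray (g : PGL(2, K)) (i : ℤ) :
    (tree p K).Adj (g • refVertex p K (-i)) (g • refVertex p K (-(i + 1))) := by
  rw [← SimpleGraph.dist_eq_one_iff_adj]
  exact_mod_cast dist_ray p hK g i 1

lemma ray_adj (g : PGL(2, K)) (n : ℕ) :
    (tree p K).Adj (g • refVertex p K (-(n : ℤ))) (g • refVertex p K (-((n + 1 : ℕ) : ℤ))) := by
  exact_mod_cast adj_ray p hK g n

lemma ray_ne (g : PGL(2, K)) (n : ℕ) :
    g • refVertex p K (-(n : ℤ)) ≠ g • refVertex p K (-((n + 2 : ℕ) : ℤ)) := by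
  intro h
  have h1 := dist_ray p hK g n 2
  have h2 : (n : ℤ) + (2 : ℕ) = ((n + 2 : ℕ) : ℤ) := by push_cast; rfl
  rw [h2, ← h, SimpleGraph.dist_self] at h1
  omega

/-- Two rays with the same end agree, up to a shift, from some vertex on. -/
lemma exists_ray_shift {g g' : PGL(2, K)} (h : g • infPt K = g' • infPt K) :
    ∃ e N : ℤ, ∀ m, N ≤ m → g' • refVertex p K (-m) = g • refVertex p K (-(m + e)) := by
  have := isUltrametricDist p K
  have hp := prime_pos p
  have hp1 := one_lt_prime p
  obtain ⟨b, rfl⟩ : ∃ b, g' = g * b := ⟨g⁻¹ * g', by group⟩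
  obtain ⟨B, rfl⟩ := Matrix.ProjGenLinGroup.mk_surjective b
  have hinf : infPt K = Matrix.ProjGenLinGroup.mk B • infPt K := by
    rw [mul_smul] at h
    exact MulAction.injective g h
  have hc : B.1 1 0 = 0 := by
    rw [infPt, Projectivization.PGL.mk_smul_mk, Projectivization.mk_eq_mk_iff'] at hinf
    obtain ⟨a, ha⟩ := hinf
    have e : B • ![(1 : K), 0] = B.1.mulVec ![1, 0] := rfl
    rw [e] at ha
    have h0 := congrFun ha 0
    have h1 := congrFun ha 1
    simp at h0 h1
    refine h1.resolve_left ?_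
    rintro rfl
    simp at h0
  have hdet : B.1.det = B.1 0 0 * B.1 1 1 := by
    rw [Matrix.det_fin_two, hc]
    ring
  have hdet0 : B.1.det ≠ 0 := norm_pos_iff.mp (norm_det_pos B)
  rw [hdet] at hdet0
  have ha0 := left_ne_zero_of_mul hdet0
  have hd0 := right_ne_zero_of_mul hdet0
  have hdn : 0 < ‖B.1 1 1‖ := norm_pos_iff.mpr hd0
  obtain ⟨e, he⟩ := exists_norm_eq_zpow p hK (div_ne_zero ha0 hd0)
  rw [norm_div, div_eq_iff hdn.ne'] at he
  obtain ⟨N, hN⟩ : ∃ N : ℕ, ‖B.1 0 1‖ / ‖B.1 1 1‖ < (p : ℝ) ^ N :=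
    pow_unbounded_of_one_lt _ hp1
  refine ⟨-e, N + e, fun m hm => ?_⟩
  rw [mul_smul]
  congr 1
  rw [refVertex_eq, refVertex_eq, mk_smul_vertexOf, eq_comm, vertexOf_eq_iff, refGL_inv,
    ← mul_assoc]
  have hval : (refGL p K (-(-(m + -e))) * B * refGL p K (-m)).1 =
      !![((unif p K ^ (-e) : Kˣ) : K) * B.1 0 0, ((unif p K ^ (m - e) : Kˣ) : K) * B.1 0 1;
        0, B.1 1 1] := by
    have : -e = (-(-(m + -e))) + -m := by ring
    rw [mul_refGL_val, refGL_mul_val, hc, this, zpow_add, neg_neg, ← sub_eq_add_neg m e]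
    ext i j
    fin_cases i <;> fin_cases j <;> simp
    ring
  have h00 : ‖((unif p K ^ (-e) : Kˣ) : K) * B.1 0 0‖ = ‖B.1 1 1‖ := by
    rw [norm_mul, he, norm_unif_zpow, ← mul_assoc, ← zpow_add₀ hp.ne']
    simp
  have h01 : ‖((unif p K ^ (m - e) : Kˣ) : K) * B.1 0 1‖ ≤ ‖B.1 1 1‖ := by
    rw [div_lt_iff₀ hdn] at hN
    rw [norm_mul, norm_unif_zpow]
    calc (p : ℝ) ^ (-(m - e)) * ‖B.1 0 1‖ ≤ (p : ℝ) ^ (-(N : ℤ)) * (p ^ N * ‖B.1 1 1‖) := by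
          gcongr
          · exact hp1.le
          · omega
      _ = ‖B.1 1 1‖ := by
          rw [← mul_assoc, zpow_neg, zpow_natCast, inv_mul_cancel₀ (pow_pos hp N).ne', one_mul]
  rw [distortion, hval, Matrix.det_fin_two_of, mul_zero, sub_zero, norm_mul, h00]
  have : entryNorm !![((unif p K ^ (-e) : Kˣ) : K) * B.1 0 0,
      ((unif p K ^ (m - e) : Kˣ) : K) * B.1 0 1; 0, B.1 1 1] = ‖B.1 1 1‖ := by
    simp only [entryNorm, Matrix.of_apply, Matrix.cons_val', Matrix.cons_val_zero,
      Matrix.cons_val_one, Matrix.cons_val_fin_one, norm_zero]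
    rw [h00, max_eq_left h01, max_eq_right hdn.le, max_self]
  rw [this, sq, div_self (mul_pos hdn hdn).ne']

/-- Membership in the limit set can be tested along any ray which ends in the given point. -/
lemma smul_infPt_mem_limitSet_iff (Γ : Subgroup PGL(2, K)) (g : PGL(2, K)) :
    g • infPt K ∈ limitSet p Γ ↔ ∀ n : ℕ, ∃ γ ∈ Γ, γ • refVertex p K 0 ∈
      (tree p K).half (g • refVertex p K (-(n : ℤ))) (g • refVertex p K (-((n + 1 : ℕ) : ℤ))) := by
  constructor
  · rintro ⟨g', hg', h⟩ n
    obtain ⟨e, N, hs⟩ := exists_ray_shift p hK hg'.symm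
    obtain ⟨m, hm1, hm2⟩ : ∃ m : ℕ, N ≤ m ∧ (n : ℤ) ≤ m + e :=
      ⟨(max N (n - e)).toNat, by omega, by omega⟩
    obtain ⟨γ, hγ, hmem⟩ := h m
    refine ⟨γ, hγ, ?_⟩
    obtain ⟨l, hl⟩ := Int.eq_ofNat_of_zero_le (show 0 ≤ (m : ℤ) + e by omega)
    have hanti := (tree_uniqueDescent p hK).half_ray_antitone (ray_adj p hK g) (ray_ne p hK g)
      (show n ≤ l by omega)
    refine hanti ?_
    have h1 := hs m hm1
    have h2 := hs (m + 1) (by omega)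
    have h4 : (m : ℤ) + e = (l : ℕ) := hl
    have h3 : (m : ℤ) + 1 + e = (l + 1 : ℕ) := by push_cast; rw [← h4]; ring
    rw [h4] at h1
    rw [h3] at h2
    beta_reduce
    rw [← h1, ← h2]
    exact hmem
  · intro h
    refine ⟨g, rfl, fun n => ?_⟩
    obtain ⟨γ, hγ, hmem⟩ := h n
    exact ⟨γ, hγ, by exact_mod_cast hmem⟩

end BruhatTits

/-! ### Schottky groups act freely and properly -/

/-- The ping-pong lemma for a point: if `x₀` lies in none of the disjoint sets `O`, and each
letter `f i`, `(f i)⁻¹` maps the complement of the set of the opposite letter into its own set,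
then no nontrivial element of the group generated by the `f i` fixes `x₀`. -/
lemma eq_one_of_ping_pong {ι G V : Type*} [Group G] [MulAction G V] (f : ι → G)
    (O : ι × Bool → Set V) (hdisj : Pairwise (Function.onFun Disjoint O))
    (hO : ∀ i b x, x ∉ O (i, !b) → cond b (f i) (f i)⁻¹ • x ∈ O (i, b))
    {x₀ : V} (hx₀ : ∀ l, x₀ ∉ O l) {g : G} (hg : g ∈ Subgroup.closure (Set.range f))
    (hgx : g • x₀ = x₀) : g = 1 := by
  classical
  rw [← FreeGroup.range_lift_eq_closure] at hg
  obtain ⟨w, rfl⟩ := hg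
  have key : ∀ (L : List (ι × Bool)) (l : ι × Bool), FreeGroup.IsReduced (l :: L) →
      ((l :: L).map fun x => cond x.2 (f x.1) (f x.1)⁻¹).prod • x₀ ∈ O l := by
    intro L
    induction L with
    | nil =>
      rintro ⟨i, b⟩ -
      simpa using hO i b x₀ (hx₀ _)
    | cons m L ih =>
      rintro ⟨i, b⟩ hred
      rw [FreeGroup.IsReduced, List.isChain_cons_cons] at hred
      have h1 := ih m hred.2
      rw [List.map_cons, List.prod_cons, mul_smul]
      refine hO i b _ fun h2 => ?_
      refine Set.disjoint_left.mp (hdisj (i := m) (j := (i, !b)) ?_) h1 h2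
      rintro rfl
      simpa using hred.1 rfl
  rcases hw : w.toWord with _ | ⟨l, L⟩
  · rw [FreeGroup.toWord_eq_nil_iff] at hw
    rw [hw, map_one]
  · exfalso
    have hred : FreeGroup.IsReduced w.toWord := FreeGroup.isReduced_toWord
    rw [hw] at hred
    have := key L l hred
    rw [← FreeGroup.lift_mk, ← hw, FreeGroup.mk_toWord, hgx] at this
    exact hx₀ l this

lemma countable_closure_range {ι G : Type*} [Countable ι] [Group G] (f : ι → G) :
    Countable (Subgroup.closure (Set.range f)) := by
  classical
  rw [← FreeGroup.range_lift_eq_closure]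
  have : Countable (FreeGroup ι) := FreeGroup.toWord_injective.countable
  exact (FreeGroup.lift f).rangeRestrict_surjective.countable

namespace BruhatTits

variable (p : ℕ) [Fact p.Prime] {K : Type*} [NormedField K] [NormedAlgebra ℚ_[p] K]

omit [Fact p.Prime] [NormedAlgebra ℚ_[p] K] in
lemma diagElt_mul (a b : Kˣ) :
    diagElt a * diagElt b = diagElt (a * b) := by
  rw [diagElt, diagElt, diagElt, ← map_mul]
  congr 1
  ext i j
  fin_cases i <;> fin_cases j <;> simp

lemma diagElt_smul_refVertex {a : Kˣ} (ha : ‖(a : K)‖ = 1) (j : ℤ) :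
    diagElt a • refVertex p K j = refVertex p K j := by
  have h : diagElt a ∈ maxCompact p K := by
    rw [diagElt, mk_mem_maxCompact_iff, distortion]
    simp [Matrix.GeneralLinearGroup.mkOfDetNeZero, entryNorm, ha]
  change (QuotientGroup.mk (diagElt a * diagElt (unif p K ^ j)) : Vertex p K) =
    QuotientGroup.mk (diagElt (unif p K ^ j))
  rw [diagElt_mul, mul_comm, ← diagElt_mul, eq_comm, QuotientGroup.eq, inv_mul_cancel_left]
  exact h

/-- A hyperbolic element shifts its axis by its translation length. -/
lemma IsAxisLabelling.smul_eq {γ : PGL(2, K)} {n : ℕ} {v : ℤ → Vertex p K}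
    (h : IsAxisLabelling p γ n v) (j : ℤ) : γ • v j = v (j + n) := by
  obtain ⟨-, g, a, ha, rfl, hv⟩ := h
  rw [hv, hv, mul_smul, mul_smul, inv_smul_smul]
  congr 1
  rw [← diagElt_mul, mul_smul, diagElt_smul_refVertex p ha]
  change (QuotientGroup.mk (diagElt (unif p K ^ (-(n : ℤ))) * diagElt (unif p K ^ (-j))) :
    Vertex p K) = QuotientGroup.mk (diagElt (unif p K ^ (-(j + n))))
  rw [diagElt_mul, ← zpow_add]
  congr 3
  ring

variable (hK : ∀ x : K, ∃ y : ℚ_[p], ‖x‖ = ‖y‖)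
include hK

lemma IsAxisLabelling.adj {γ : PGL(2, K)} {n : ℕ} {v : ℤ → Vertex p K}
    (h : IsAxisLabelling p γ n v) (j : ℤ) : (tree p K).Adj (v j) (v (j + 1)) := by
  obtain ⟨-, g, -, -, -, hv⟩ := h
  rw [hv, hv]
  exact adj_ray p hK g j

lemma smul_mem_half_iff (g : PGL(2, K)) (v w x : Vertex p K) :
    g • x ∈ (tree p K).half (g • v) (g • w) ↔ x ∈ (tree p K).half v w := by
  simp only [SimpleGraph.half, Set.mem_ofPred_eq, dist_smul p hK]

/-- A Schottky group acts freely on the orbit of some vertex, namely of any vertex outside the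
disjoint half trees of its definition. -/
lemma exists_stabilizer_trivial {n : ℕ} (hn : 2 ≤ n) {γ : Fin n → PGL(2, K)}
    (hγ : IsSchottkyBasis p γ) :
    ∃ x₀ : Vertex p K, ∀ g ∈ Subgroup.closure (Set.range γ), g • x₀ = x₀ → g = 1 := by
  have hT := tree_uniqueDescent p hK
  obtain ⟨len, v, hax, hdisj⟩ := hγ
  let O : Fin n × Bool → Set (Vertex p K) := fun l =>
    cond l.2 ((tree p K).half (v l.1 (len l.1)) (v l.1 (len l.1 + 1)))
      ((tree p K).half (v l.1 1) (v l.1 0))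
  have hOdisj : Pairwise (Function.onFun Disjoint O) := by
    rintro ⟨i, b⟩ ⟨j, c⟩ hne
    cases b <;> cases c
    · exact hdisj (i := .inr i) (j := .inr j) (by simpa using hne)
    · exact hdisj (i := .inr i) (j := .inl j) (by simp)
    · exact hdisj (i := .inl i) (j := .inr j) (by simp)
    · exact hdisj (i := .inl i) (j := .inl j) (by simpa using hne)
  have hedge : ∀ l, ∃ a b, (tree p K).Adj a b ∧ O l = (tree p K).half a b := by
    rintro ⟨i, b⟩
    cases b
    · exact ⟨_, _, ((hax i).adj p hK 0).symm, rfl⟩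
    · exact ⟨_, _, (hax i).adj p hK (len i), rfl⟩
  have hpp : ∀ i b x, x ∉ O (i, !b) → cond b (γ i) (γ i)⁻¹ • x ∈ O (i, b) := by
    intro i b x hx
    have h0 := (hax i).smul_eq p 0
    have h1 := (hax i).smul_eq p 1
    rw [zero_add] at h0
    rw [add_comm] at h1
    cases b
    · have h := hT.mem_half_swap ((hax i).adj p hK (len i)) hx
      rw [← h0, ← h1] at h
      change (γ i)⁻¹ • x ∈ (tree p K).half (v i 1) (v i 0)
      rwa [← smul_mem_half_iff p hK (γ i), smul_inv_smul]
    · have h := hT.mem_half_swap ((hax i).adj p hK 0).symm hx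
      change γ i • x ∈ (tree p K).half (v i (len i)) (v i (len i + 1))
      rw [← h0, ← h1, smul_mem_half_iff p hK]
      exact h
  -- The end `v 1` of the edge that cuts off the first half tree lies in no half tree `O l`:
  -- otherwise `O l` would be the complement of the first half tree, and a third one had no room.
  let i₀ : Fin n := ⟨0, by omega⟩
  have hadj : (tree p K).Adj (v i₀ 1) (v i₀ 0) := ((hax i₀).adj p hK 0).symm
  refine ⟨v i₀ 1, fun g hg hgx => eq_one_of_ping_pong γ O hOdisj hpp ?_ hg hgx⟩
  intro l hl
  have hO₀ : O (i₀, false) = (tree p K).half (v i₀ 1) (v i₀ 0) := rfl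
  have hne : l ≠ (i₀, false) := by
    rintro rfl
    exact SimpleGraph.UniqueDescent.notMem_half_swap hl
      (SimpleGraph.UniqueDescent.right_mem_half hadj.symm)
  obtain ⟨a, b, hab, hOl⟩ := hedge l
  have h0 : v i₀ 0 ∉ O l := fun h => Set.disjoint_left.mp (hOdisj hne) h
    (hO₀ ▸ SimpleGraph.UniqueDescent.right_mem_half hadj)
  rw [hOl] at hl h0
  obtain ⟨h1, h2⟩ := hT.eq_of_adj_of_mem_half hab hadj hl (hT.mem_half_swap hab h0)
  obtain ⟨m, hm1, hm2⟩ : ∃ m, m ≠ l ∧ m ≠ (i₀, false) := by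
    let i₁ : Fin n := ⟨1, by omega⟩
    have h01 : i₁ ≠ i₀ := by simp [i₀, i₁]
    rcases eq_or_ne l (i₁, false) with rfl | h
    · exact ⟨(i₁, true), by simp, by simp⟩
    · exact ⟨(i₁, false), h.symm, by simpa using h01⟩
  obtain ⟨a', b', hab', hOm⟩ := hedge m
  have hb' : b' ∈ O m := hOm ▸ SimpleGraph.UniqueDescent.right_mem_half hab'
  have h3 : b' ∉ O l := Set.disjoint_left.mp (hOdisj hm1) hb'
  have h4 : b' ∉ O (i₀, false) := Set.disjoint_left.mp (hOdisj hm2) hb'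
  rw [hOl] at h3
  rw [hO₀, h1, h2] at h4
  exact h4 (hT.mem_half_swap hab h3)

end BruhatTits

/-! ### Circles and their stabilizers -/

namespace BruhatTits

variable (p : ℕ) [Fact p.Prime] {K : Type*} [NormedField K] [NormedAlgebra ℚ_[p] K]

/-- The vector `v` is proportional to a vector with coordinates in `ℚ_p`. -/
def IsRationalDirection (v : Fin 2 → K) : Prop :=
  v 1 = 0 ∨ v 0 / v 1 ∈ Set.range (algebraMap ℚ_[p] K)

/-- A vector over `ℚ_p`, seen in `K²`. -/
noncomputable def extendVec (K : Type*) [NormedField K] [NormedAlgebra ℚ_[p] K]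
    (w : Fin 2 → ℚ_[p]) : Fin 2 → K := fun i => algebraMap ℚ_[p] K (w i)

/-- The inclusion of `GL₂(ℚ_p)` into `GL₂(K)`. -/
noncomputable def extendGL (K : Type*) [NormedField K] [NormedAlgebra ℚ_[p] K] :
    GL (Fin 2) ℚ_[p] →* GL (Fin 2) K :=
  Matrix.GeneralLinearGroup.map (algebraMap ℚ_[p] K)

lemma extendGL_apply (B : GL (Fin 2) ℚ_[p]) (i j : Fin 2) :
    (extendGL p K B).1 i j = algebraMap ℚ_[p] K (B.1 i j) := rfl

lemma distortion_extendGL (B : GL (Fin 2) ℚ_[p]) : distortion (extendGL p K B) = distortion B := by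
  have h : (extendGL p K B).1.det = algebraMap ℚ_[p] K B.1.det :=
    ((algebraMap ℚ_[p] K).map_det B.1).symm
  rw [distortion, distortion, h, entryNorm, entryNorm]
  simp only [extendGL_apply, norm_algebraMap']

lemma extendGL_refGL (j : ℤ) : extendGL p K (refGL p ℚ_[p] j) = refGL p K j := by
  have hu : algebraMap ℚ_[p] K (unif p ℚ_[p] : ℚ_[p]) = (unif p K : K) := rfl
  ext i k
  rw [extendGL_apply, refGL_val, refGL_val]
  fin_cases i <;> fin_cases k <;> simp [hu]

lemma IsRationalDirection.exists_smul {v : Fin 2 → K} (hv0 : v ≠ 0)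
    (hv : IsRationalDirection p v) : ∃ (c : K) (w : Fin 2 → ℚ_[p]), c ≠ 0 ∧ w ≠ 0 ∧
      v = c • extendVec p K w := by
  by_cases h1 : v 1 = 0
  · refine ⟨v 0, ![1, 0], fun h0 => hv0 ?_, fun h => by simpa using congrFun h 0, ?_⟩
    · ext i
      fin_cases i
      · exact h0
      · exact h1
    · ext i
      fin_cases i <;> simp [extendVec, h1]
  · obtain ⟨a, ha⟩ := hv.resolve_left h1
    refine ⟨v 1, ![a, 1], h1, fun h => by simpa using congrFun h 1, ?_⟩
    ext i
    fin_cases i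
    · simp only [extendVec, Pi.smul_apply, smul_eq_mul]
      change v 0 = v 1 * algebraMap ℚ_[p] K a
      rw [ha]
      field_simp
    · simp [extendVec]

lemma isRationalDirection_smul_extendVec (c : K) (w : Fin 2 → ℚ_[p]) :
    IsRationalDirection p (c • extendVec p K w) := by
  by_cases h : c = 0 ∨ w 1 = 0
  · left
    rcases h with h | h <;> simp [extendVec, h]
  · push Not at h
    refine .inr ⟨w 0 / w 1, ?_⟩
    rw [map_div₀]
    simp only [extendVec, Pi.smul_apply, smul_eq_mul]
    rw [mul_div_mul_left _ _ h.1]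

lemma isClosed_range_algebraMap : IsClosed (Set.range (algebraMap ℚ_[p] K)) :=
  (algebraMap_isometry ℚ_[p] K).isClosedEmbedding.isClosed_range

lemma isClosed_isRationalDirection : IsClosed {v : Fin 2 → K | IsRationalDirection p v} := by
  rw [← isOpen_compl_iff]
  have : {v : Fin 2 → K | IsRationalDirection p v}ᶜ = {v | v 1 ≠ 0} ∩
      (fun v : Fin 2 → K => v 0 / v 1) ⁻¹' (Set.range (algebraMap ℚ_[p] K))ᶜ := by
    ext v
    simp [IsRationalDirection]
  rw [this]
  refine ContinuousOn.isOpen_inter_preimage ?_ ?_ (isClosed_range_algebraMap p).isOpen_compl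
  · exact ContinuousOn.div (by fun_prop) (by fun_prop) fun v hv => hv
  · exact isOpen_ne_fun (by fun_prop) (by fun_prop)

lemma mk_mem_qpLine_iff {v : Fin 2 → K} (hv : v ≠ 0) :
    Projectivization.mk K v hv ∈ qpLine p K ↔ IsRationalDirection p v := by
  constructor
  · rintro (h | ⟨a, h⟩)
    · rw [infPt, Projectivization.mk_eq_mk_iff'] at h
      obtain ⟨c, rfl⟩ := h
      left
      simp
    · beta_reduce at h
      rw [finPt, eq_comm, Projectivization.mk_eq_mk_iff'] at h
      obtain ⟨c, rfl⟩ := h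
      have : c • ![algebraMap ℚ_[p] K a, 1] = c • extendVec p K ![a, 1] := by
        congr 1
        ext i
        fin_cases i <;> simp [extendVec]
      rw [this]
      exact isRationalDirection_smul_extendVec p c _
  · intro h
    by_cases h1 : v 1 = 0
    · left
      rw [infPt, Projectivization.mk_eq_mk_iff']
      refine ⟨v 0, ?_⟩
      ext i
      fin_cases i <;> simp [h1]
    · obtain ⟨a, ha⟩ := h.resolve_left h1
      right
      refine ⟨a, ?_⟩
      beta_reduce
      rw [finPt, eq_comm, Projectivization.mk_eq_mk_iff']
      refine ⟨v 1, ?_⟩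
      ext i
      fin_cases i
      · simp [ha, mul_div_cancel₀ _ h1]
      · simp

lemma mulVec_ne_zero (A : GL (Fin 2) K) {v : Fin 2 → K} (hv : v ≠ 0) : A.1.mulVec v ≠ 0 := by
  intro h
  apply hv
  have := congrArg (A⁻¹.1.mulVec) h
  rwa [Matrix.mulVec_mulVec, ← Units.val_mul, inv_mul_cancel, Units.val_one, Matrix.one_mulVec,
    Matrix.mulVec_zero] at this

lemma mk_smul_mk (A : GL (Fin 2) K) {v : Fin 2 → K} (hv : v ≠ 0) :
    Matrix.ProjGenLinGroup.mk A • Projectivization.mk K v hv =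
      Projectivization.mk K (A.1.mulVec v) (mulVec_ne_zero A hv) := rfl

lemma extendGL_mulVec (B : GL (Fin 2) ℚ_[p]) (w : Fin 2 → ℚ_[p]) :
    (extendGL p K B).1.mulVec (extendVec p K w) = extendVec p K (B.1.mulVec w) := by
  ext i
  simp [Matrix.mulVec, dotProduct, extendVec, extendGL_apply]

lemma extendGL_smul_qpLine (B : GL (Fin 2) ℚ_[p]) :
    Matrix.ProjGenLinGroup.mk (extendGL p K B) • qpLine p K = qpLine p K := by
  have sub : ∀ B : GL (Fin 2) ℚ_[p],
      Matrix.ProjGenLinGroup.mk (extendGL p K B) • qpLine p K ⊆ qpLine p K := by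
    rintro B - ⟨x, hx, rfl⟩
    induction x using Projectivization.ind with | h v hv =>
    rw [mk_mem_qpLine_iff] at hx
    obtain ⟨c, w, -, -, rfl⟩ := hx.exists_smul p hv
    beta_reduce
    rw [mk_smul_mk, mk_mem_qpLine_iff, Matrix.mulVec_smul, extendGL_mulVec]
    exact isRationalDirection_smul_extendVec p c _
  refine (sub B).antisymm ?_
  rw [Set.subset_smul_set_iff, ← map_inv, ← map_inv]
  exact sub B⁻¹

/-- The stabilizer of the line `ℚ_p ∪ {∞}` is `PGL₂(ℚ_p)`: if the images of `0`, `1` and `∞` lie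
on the line, then Cramer's rule shows that the matrix is proportional to one over `ℚ_p`. -/
lemma exists_extendGL_of_isRationalDirection {A : GL (Fin 2) K}
    (h0 : IsRationalDirection p (A.1.mulVec ![1, 0]))
    (h1 : IsRationalDirection p (A.1.mulVec ![0, 1]))
    (h2 : IsRationalDirection p (A.1.mulVec ![1, 1])) :
    ∃ (B : GL (Fin 2) ℚ_[p]) (u : Kˣ), A = extendGL p K B * .scalar (Fin 2) u := by
  obtain ⟨a, x, ha, -, hx⟩ := h0.exists_smul p (mulVec_ne_zero A fun h => by
    simpa using congrFun h 0)
  obtain ⟨b, y, hb, -, hy⟩ := h1.exists_smul p (mulVec_ne_zero A fun h => by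
    simpa using congrFun h 1)
  obtain ⟨c, z, hc, -, hz⟩ := h2.exists_smul p (mulVec_ne_zero A fun h => by
    simpa using congrFun h 0)
  have e00 : A.1 0 0 = a * algebraMap ℚ_[p] K (x 0) := by
    simpa [extendVec, Matrix.mulVec, dotProduct] using congrFun hx 0
  have e10 : A.1 1 0 = a * algebraMap ℚ_[p] K (x 1) := by
    simpa [extendVec, Matrix.mulVec, dotProduct] using congrFun hx 1
  have e01 : A.1 0 1 = b * algebraMap ℚ_[p] K (y 0) := by
    simpa [extendVec, Matrix.mulVec, dotProduct] using congrFun hy 0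
  have e11 : A.1 1 1 = b * algebraMap ℚ_[p] K (y 1) := by
    simpa [extendVec, Matrix.mulVec, dotProduct] using congrFun hy 1
  have f0 : A.1 0 0 + A.1 0 1 = c * algebraMap ℚ_[p] K (z 0) := by
    simpa [extendVec, Matrix.mulVec, dotProduct] using congrFun hz 0
  have f1 : A.1 1 0 + A.1 1 1 = c * algebraMap ℚ_[p] K (z 1) := by
    simpa [extendVec, Matrix.mulVec, dotProduct] using congrFun hz 1
  have hdet0 : A.1.det ≠ 0 := norm_pos_iff.mp (norm_det_pos A)
  set d := x 0 * y 1 - y 0 * x 1 with hd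
  have hAd : A.1.det = a * b * algebraMap ℚ_[p] K d := by
    rw [Matrix.det_fin_two, e00, e10, e01, e11, hd]
    simp only [map_sub, map_mul]
    ring
  have hd0 : d ≠ 0 := by
    intro h
    rw [hAd, h, map_zero, mul_zero] at hdet0
    exact hdet0 rfl
  have hd0' : algebraMap ℚ_[p] K d ≠ 0 := by simpa using hd0
  set s := (z 0 * y 1 - y 0 * z 1) / d with hs
  set t := (x 0 * z 1 - z 0 * x 1) / d with ht
  have has : a = c * algebraMap ℚ_[p] K s := by
    rw [hs, map_div₀, ← mul_div_assoc, eq_div_iff hd0', hd]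
    simp only [map_sub, map_mul]
    rw [e00, e01] at f0
    rw [e10, e11] at f1
    linear_combination algebraMap ℚ_[p] K (y 1) * f0 - algebraMap ℚ_[p] K (y 0) * f1
  have hbt : b = c * algebraMap ℚ_[p] K t := by
    rw [ht, map_div₀, ← mul_div_assoc, eq_div_iff hd0', hd]
    simp only [map_sub, map_mul]
    rw [e00, e01] at f0
    rw [e10, e11] at f1
    linear_combination algebraMap ℚ_[p] K (x 0) * f1 - algebraMap ℚ_[p] K (x 1) * f0
  have hs0 : s ≠ 0 := by
    rintro h
    rw [h, map_zero, mul_zero] at has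
    exact ha has
  have ht0 : t ≠ 0 := by
    rintro h
    rw [h, map_zero, mul_zero] at hbt
    exact hb hbt
  refine ⟨Matrix.GeneralLinearGroup.mkOfDetNeZero !![s * x 0, t * y 0; s * x 1, t * y 1] ?_,
    Units.mk0 c hc, ?_⟩
  · rw [Matrix.det_fin_two_of]
    have : s * x 0 * (t * y 1) - t * y 0 * (s * x 1) = s * t * d := by
      rw [hd]
      ring
    rw [this]
    exact mul_ne_zero (mul_ne_zero hs0 ht0) hd0
  · apply Units.ext
    rw [mul_scalar_val]
    ext i j
    rw [Matrix.smul_apply, extendGL_apply, Units.val_mk0, smul_eq_mul]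
    fin_cases i <;> fin_cases j
    · change A.1 0 0 = c * algebraMap ℚ_[p] K (s * x 0)
      rw [e00, has, map_mul, mul_assoc]
    · change A.1 0 1 = c * algebraMap ℚ_[p] K (t * y 0)
      rw [e01, hbt, map_mul, mul_assoc]
    · change A.1 1 0 = c * algebraMap ℚ_[p] K (s * x 1)
      rw [e10, has, map_mul, mul_assoc]
    · change A.1 1 1 = c * algebraMap ℚ_[p] K (t * y 1)
      rw [e11, hbt, map_mul, mul_assoc]

lemma smul_qpLine_eq_iff (A : GL (Fin 2) K) :
    Matrix.ProjGenLinGroup.mk A • qpLine p K = qpLine p K ↔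
      IsRationalDirection p (A.1.mulVec ![1, 0]) ∧ IsRationalDirection p (A.1.mulVec ![0, 1]) ∧
        IsRationalDirection p (A.1.mulVec ![1, 1]) := by
  constructor
  · intro h
    have key : ∀ v : Fin 2 → K, v ≠ 0 → IsRationalDirection p v →
        IsRationalDirection p (A.1.mulVec v) := by
      intro v hv0 hv
      rw [← mk_mem_qpLine_iff p hv0] at hv
      rw [← mk_mem_qpLine_iff p (mulVec_ne_zero A hv0), ← mk_smul_mk A hv0, ← h]
      exact Set.smul_mem_smul_set hv
    exact ⟨key _ (fun h => by simpa using congrFun h 0) (.inl (by simp)),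
      key _ (fun h => by simpa using congrFun h 1) (.inr ⟨0, by simp⟩),
      key _ (fun h => by simpa using congrFun h 0) (.inr ⟨1, by simp⟩)⟩
  · rintro ⟨h0, h1, h2⟩
    obtain ⟨B, u, rfl⟩ := exists_extendGL_of_isRationalDirection p h0 h1 h2
    rw [map_mul, Matrix.ProjGenLinGroup.mk_scalar, mul_one, extendGL_smul_qpLine]

variable (K) in
lemma isClosed_setOf_smul_qpLine_eq :
    IsClosed {A : GL (Fin 2) K | Matrix.ProjGenLinGroup.mk A • qpLine p K = qpLine p K} := by
  simp only [smul_qpLine_eq_iff]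
  have h : ∀ v : Fin 2 → K,
      IsClosed {A : GL (Fin 2) K | IsRationalDirection p (A.1.mulVec v)} := fun v =>
    (isClosed_isRationalDirection p).preimage
      (Continuous.matrix_mulVec Units.continuous_val continuous_const)
  exact (h _).inter ((h _).inter (h _))

lemma smul_mkCircle (g g' : PGL(2, K)) : g • mkCircle p K g' = mkCircle p K (g * g') :=
  Subtype.ext (mul_smul g g' (qpLine p K)).symm

lemma exists_mkCircle_eq (C : CircleSpace p K) : ∃ g, mkCircle p K g = C := by
  obtain ⟨_, g, rfl⟩ := C
  exact ⟨g, rfl⟩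

lemma mkCircle_eq_iff (g g' : PGL(2, K)) :
    mkCircle p K g = mkCircle p K g' ↔ (g⁻¹ * g') • qpLine p K = qpLine p K := by
  rw [mul_smul, inv_smul_eq_iff, eq_comm]
  exact Subtype.ext_iff

lemma mkCircle_mul_extendGL (g : PGL(2, K)) (B : GL (Fin 2) ℚ_[p]) :
    mkCircle p K (g * Matrix.ProjGenLinGroup.mk (extendGL p K B)) = mkCircle p K g := by
  rw [eq_comm, mkCircle_eq_iff, inv_mul_cancel_left, extendGL_smul_qpLine]

lemma exists_eq_mul_extendGL {g g' : PGL(2, K)} (h : mkCircle p K g = mkCircle p K g') :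
    ∃ B : GL (Fin 2) ℚ_[p], g' = g * Matrix.ProjGenLinGroup.mk (extendGL p K B) := by
  rw [mkCircle_eq_iff] at h
  obtain ⟨A, hA⟩ := Matrix.ProjGenLinGroup.mk_surjective (g⁻¹ * g')
  rw [← hA, smul_qpLine_eq_iff] at h
  obtain ⟨B, u, rfl⟩ := exists_extendGL_of_isRationalDirection p h.1 h.2.1 h.2.2
  refine ⟨B, ?_⟩
  rw [map_mul, Matrix.ProjGenLinGroup.mk_scalar, mul_one] at hA
  rw [hA, mul_inv_cancel_left]

/-! ### The subtree spanned by a circle -/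

variable {p} in
/-- The vertices of the subtree spanned by the circle `C`: it is the translate by `g` of the
Bruhat-Tits tree of `PGL₂(ℚ_p)`, for any `g` with `C = g (ℚ_p ∪ {∞})`. -/
def CircleSpace.hull (C : CircleSpace p K) : Set (Vertex p K) :=
  {x | ∃ g, mkCircle p K g = C ∧ g • refVertex p K 0 = x}

lemma smul_mem_hull {C : CircleSpace p K} {x : Vertex p K} (g : PGL(2, K)) (hx : x ∈ C.hull) :
    g • x ∈ (g • C).hull := by
  obtain ⟨k, rfl, rfl⟩ := hx
  exact ⟨g * k, (smul_mkCircle p g k).symm, mul_smul _ _ _⟩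

lemma hull_nonempty (C : CircleSpace p K) : C.hull.Nonempty := by
  obtain ⟨g, hg⟩ := exists_mkCircle_eq p C
  exact ⟨_, g, hg, rfl⟩

lemma smul_refVertex_mem_hull {C : CircleSpace p K} {g : PGL(2, K)} (hg : mkCircle p K g = C)
    (j : ℤ) : g • refVertex p K j ∈ C.hull := by
  refine ⟨g * Matrix.ProjGenLinGroup.mk (extendGL p K (refGL p ℚ_[p] j)), ?_, ?_⟩
  · rw [mkCircle_mul_extendGL, hg]
  · rw [mul_smul, extendGL_refGL, refVertex_eq, refVertex_eq, mk_smul_vertexOf, refGL_zero, mul_one]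

/-- Each point of a circle is the end of a ray in the subtree of the circle. -/
lemma exists_smul_infPt_eq {C : CircleSpace p K} {ξ : ℙ K (Fin 2 → K)} (hξ : ξ ∈ C.points) :
    ∃ g, mkCircle p K g = C ∧ g • infPt K = ξ := by
  obtain ⟨g, rfl⟩ := exists_mkCircle_eq p C
  obtain ⟨η, hη, rfl⟩ : ξ ∈ g • qpLine p K := hξ
  have key : ∃ B : GL (Fin 2) ℚ_[p], Matrix.ProjGenLinGroup.mk (extendGL p K B) • infPt K = η := by
    rcases hη with rfl | ⟨a, rfl⟩
    · exact ⟨1, by simp⟩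
    · refine ⟨Matrix.GeneralLinearGroup.mkOfDetNeZero !![a, 1; 1, 0] (by simp), ?_⟩
      rw [infPt, mk_smul_mk]
      beta_reduce
      rw [finPt]
      congr 1
      ext i
      rw [Matrix.mulVec, dotProduct, Fin.sum_univ_two, extendGL_apply, extendGL_apply]
      fin_cases i <;> simp [Matrix.GeneralLinearGroup.mkOfDetNeZero]
  obtain ⟨B, rfl⟩ := key
  exact ⟨_, mkCircle_mul_extendGL p g B, mul_smul _ _ _⟩

/-- If `a`, `c` satisfy approximate linear relations with primitive coefficients in `ℚ_p`, then
by compactness they satisfy an exact one. -/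
lemma isRationalDirection_of_approx {v : Fin 2 → K} (h : ∀ ε > 0, ∃ s : ℚ_[p] × ℚ_[p], ‖s‖ = 1 ∧
    ‖algebraMap ℚ_[p] K s.1 * v 0 + algebraMap ℚ_[p] K s.2 * v 1‖ < ε) :
    IsRationalDirection p v := by
  have hcont : Continuous fun s : ℚ_[p] × ℚ_[p] =>
      ‖algebraMap ℚ_[p] K s.1 * v 0 + algebraMap ℚ_[p] K s.2 * v 1‖ := by
    have := (algebraMap_isometry ℚ_[p] K).continuous
    fun_prop
  have hne : (Metric.sphere (0 : ℚ_[p] × ℚ_[p]) 1).Nonempty := by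
    obtain ⟨s, hs, -⟩ := h 1 one_pos
    exact ⟨s, by simpa using hs⟩
  obtain ⟨s, hs, hmin⟩ := (isCompact_sphere (0 : ℚ_[p] × ℚ_[p]) 1).exists_isMinOn hne
    hcont.continuousOn
  have hs1 : ‖s‖ = 1 := by simpa using hs
  have h0 : algebraMap ℚ_[p] K s.1 * v 0 + algebraMap ℚ_[p] K s.2 * v 1 = 0 := by
    by_contra hne
    obtain ⟨t, ht, hlt⟩ := h _ (norm_pos_iff.mpr hne)
    exact not_lt.mpr (hmin (a := t) (by simpa using ht)) hlt
  by_cases hv : v 1 = 0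
  · exact .inl hv
  have hs10 : s.1 ≠ 0 := by
    intro hs0
    rw [hs0, map_zero, zero_mul, zero_add, mul_eq_zero, or_iff_left hv, map_eq_zero] at h0
    have : s = 0 := Prod.ext hs0 h0
    rw [this, norm_zero] at hs1
    exact zero_ne_one hs1
  refine .inr ⟨-s.2 / s.1, ?_⟩
  have : algebraMap ℚ_[p] K s.1 ≠ 0 := by simpa using hs10
  rw [map_div₀, map_neg, div_eq_div_iff this hv]
  linear_combination -h0

/-- The ends of the rays in the subtree of a circle lie on the circle. -/
lemma smul_infPt_mem_points {C : CircleSpace p K} {g : PGL(2, K)} {N : ℕ}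
    (h : ∀ n : ℕ, N ≤ n → g • refVertex p K (-(n : ℤ)) ∈ C.hull) : g • infPt K ∈ C.points := by
  have := isUltrametricDist p K
  have hp := prime_pos p
  have hp1 := one_lt_prime p
  obtain ⟨g₀, rfl⟩ := exists_mkCircle_eq p C
  obtain ⟨A, hA⟩ := Matrix.ProjGenLinGroup.mk_surjective (g₀⁻¹ * g)
  have hgA : g = g₀ * Matrix.ProjGenLinGroup.mk A := by rw [hA, mul_inv_cancel_left]
  change g • infPt K ∈ g₀ • qpLine p K
  rw [hgA, mul_smul, Set.smul_mem_smul_set_iff, infPt, mk_smul_mk, mk_mem_qpLine_iff]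
  refine isRationalDirection_of_approx p fun ε hε => ?_
  obtain ⟨n, hn, hNn⟩ : ∃ n : ℕ, ‖A.1.det‖ / ε ^ 2 < (p : ℝ) ^ n ∧ N ≤ n := by
    obtain ⟨n, hn⟩ := pow_unbounded_of_one_lt (‖A.1.det‖ / ε ^ 2) hp1
    exact ⟨max n N, hn.trans_le (pow_le_pow_right₀ hp1.le (le_max_left _ _)), le_max_right _ _⟩
  obtain ⟨k, hk, hkn⟩ := h n hNn
  obtain ⟨B, rfl⟩ := exists_eq_mul_extendGL p hk.symm
  rw [hgA, mul_smul, mul_smul, smul_left_cancel_iff, refVertex_eq, refVertex_eq, refGL_zero,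
    mk_smul_vertexOf, mk_smul_vertexOf, mul_one, vertexOf_eq_iff, ← map_inv] at hkn
  obtain ⟨u, hu⟩ := exists_scalar_entryNorm_eq_one B⁻¹
  set L := B⁻¹ * .scalar (Fin 2) u with hL
  have hdetL : ‖L.1.det‖ ≤ 1 := by simpa [hu] using norm_det_le L.1
  -- With `L` normalized, the entries of `L A diag(p ^ (-n), 1)` are at most `√(|det A| p ^ n)`.
  have hLA : distortion (extendGL p K L * (A * refGL p K (-n))) = 1 := by
    have hc : L = .scalar (Fin 2) u * B⁻¹ := by
      rw [hL]
      ext i j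
      simp [mul_comm]
    have hs : distortion (extendGL p K (.scalar (Fin 2) u)) = 1 := by
      rw [distortion_extendGL, ← one_mul (Matrix.GeneralLinearGroup.scalar (Fin 2) u),
        distortion_mul_scalar, distortion_one]
    rw [hc, map_mul, mul_assoc, distortion_mul_eq_right hs, hkn]
  obtain ⟨i, j, hij⟩ := exists_norm_eq_entryNorm L.1
  refine ⟨(L.1 i 0, L.1 i 1), ?_, ?_⟩
  · rw [Prod.norm_def]
    apply le_antisymm
    · exact max_le ((norm_le_entryNorm _ _ _).trans hu.le) ((norm_le_entryNorm _ _ _).trans hu.le)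
    · rw [← hu, ← hij]
      fin_cases j
      · exact le_max_left _ _
      · exact le_max_right _ _
  have hdet : ‖(extendGL p K L * (A * refGL p K (-n))).1.det‖ ≤ ‖A.1.det‖ * (p : ℝ) ^ n := by
    have h1 : (extendGL p K L).1.det = algebraMap ℚ_[p] K L.1.det :=
      ((algebraMap ℚ_[p] K).map_det L.1).symm
    have h2 : ‖(refGL p K (-n)).1.det‖ = (p : ℝ) ^ n := by
      rw [refGL_val, Matrix.det_fin_two_of, mul_one, mul_zero, sub_zero, norm_unif_zpow, neg_neg,
        zpow_natCast]
    rw [Units.val_mul, Units.val_mul, Matrix.det_mul, Matrix.det_mul, norm_mul, norm_mul, h1,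
      norm_algebraMap', h2]
    exact mul_le_of_le_one_left (by positivity) hdetL
  have hent : (extendGL p K L * (A * refGL p K (-n))).1 i 0 =
      (algebraMap ℚ_[p] K (L.1 i 0) * A.1 0 0 + algebraMap ℚ_[p] K (L.1 i 1) * A.1 1 0) *
        ((unif p K ^ (-(n : ℤ)) : Kˣ) : K) := by
    have key : (extendGL p K L * A).1 i 0 = algebraMap ℚ_[p] K (L.1 i 0) * A.1 0 0 +
        algebraMap ℚ_[p] K (L.1 i 1) * A.1 1 0 := by
      rw [Units.val_mul, Matrix.mul_apply, Fin.sum_univ_two, extendGL_apply, extendGL_apply]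
    rw [← mul_assoc, mul_refGL_val, ← key]
    fin_cases i <;> rfl
  have hv0 : A.1.mulVec ![1, 0] 0 = A.1 0 0 := by simp [Matrix.mulVec, dotProduct]
  have hv1 : A.1.mulVec ![1, 0] 1 = A.1 1 0 := by simp [Matrix.mulVec, dotProduct]
  rw [hv0, hv1]
  have hle := norm_le_entryNorm (extendGL p K L * (A * refGL p K (-n))).1 i 0
  rw [distortion, div_eq_one_iff_eq (norm_det_pos _).ne'] at hLA
  rw [hent, norm_mul, norm_unif_zpow, neg_neg, zpow_natCast] at hle
  set y := algebraMap ℚ_[p] K (L.1 i 0) * A.1 0 0 + algebraMap ℚ_[p] K (L.1 i 1) * A.1 1 0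
  have hpn : (0 : ℝ) < (p : ℝ) ^ n := by positivity
  have h1 : (‖y‖ * (p : ℝ) ^ n) ^ 2 ≤ ‖A.1.det‖ * (p : ℝ) ^ n := by
    rw [← hLA] at hdet
    exact (pow_le_pow_left₀ (by positivity) hle 2).trans hdet
  have h2 : ‖y‖ ^ 2 * (p : ℝ) ^ n ≤ ‖A.1.det‖ := by
    refine le_of_mul_le_mul_right ?_ hpn
    linarith [h1, mul_pow ‖y‖ ((p : ℝ) ^ n) 2]
  rw [div_lt_iff₀ (by positivity)] at hn
  have h3 : ‖y‖ ^ 2 < ε ^ 2 := by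
    by_contra! h
    nlinarith
  exact lt_of_pow_lt_pow_left₀ 2 hε.le h3

variable (hK : ∀ x : K, ∃ y : ℚ_[p], ‖x‖ = ‖y‖)
include hK

/-- The subtree of a circle is convex, by the Cartan decomposition of `GL₂(ℚ_p)`. -/
lemma hull_separationConvex (C : CircleSpace p K) : (tree p K).SeparationConvex C.hull := by
  refine (tree_uniqueDescent p hK).separationConvex_of_paths ?_
  rintro - ⟨g, hg, rfl⟩ - ⟨g', hg', rfl⟩
  obtain ⟨B, rfl⟩ := exists_eq_mul_extendGL p (hg.trans hg'.symm)
  obtain ⟨k, n, hk, hB⟩ := exists_cartan p (K := ℚ_[p]) (fun x => ⟨x, rfl⟩) B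
  refine ⟨n, fun i => (g * Matrix.ProjGenLinGroup.mk (extendGL p K k)) • refVertex p K i,
    ?_, ?_, fun i => ?_, fun i => ?_⟩
  · beta_reduce
    rw [mul_smul, smul_left_cancel_iff, Nat.cast_zero, refVertex_eq, mk_smul_vertexOf, refGL_zero,
      mul_one, vertexOf_eq_iff, mul_one, distortion_inv, distortion_extendGL, hk]
  · beta_reduce
    rw [mul_smul, mul_smul, smul_left_cancel_iff, refVertex_eq, refVertex_eq, mk_smul_vertexOf,
      mk_smul_vertexOf, refGL_zero, mul_one, vertexOf_eq_iff, ← extendGL_refGL, ← map_mul,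
      ← map_inv,
      ← map_mul, distortion_extendGL, hB]
  · exact smul_refVertex_mem_hull p ((mkCircle_mul_extendGL p g k).trans hg) i
  · have := adj_ray p hK (g * Matrix.ProjGenLinGroup.mk (extendGL p K k)) (-(i + 1 : ℕ))
    have e : -(-((i + 1 : ℕ) : ℤ) + 1) = i := by push_cast; ring
    rw [neg_neg, e] at this
    exact this.symm

end BruhatTits

/-! ### Compactness and local finiteness -/

namespace BruhatTits

section Finiteness

variable {K : Type*} [NormedField K]

/-- The compact group `GL₂(𝒪)` inside `GL₂(K)`. -/
def integralGL (K : Type*) [NormedField K] : Set (GL (Fin 2) K) :=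
  {A | entryNorm A.1 ≤ 1 ∧ entryNorm A⁻¹.1 ≤ 1}

lemma isCompact_integralGL [ProperSpace K] : IsCompact (integralGL K) := by
  have hball : IsCompact {A : Matrix (Fin 2) (Fin 2) K | entryNorm A ≤ 1} := by
    have h : {A : Matrix (Fin 2) (Fin 2) K | entryNorm A ≤ 1} =
        Set.univ.pi fun _ => Set.univ.pi fun _ => Metric.closedBall (0 : K) 1 := by
      ext A
      exact entryNorm_le_iff.trans ⟨fun h i _ j _ => by simpa using h i j,
        fun h i j => by simpa using h i trivial j trivial⟩
    rw [h]
    exact isCompact_univ_pi fun _ => isCompact_univ_pi fun _ => isCompact_closedBall 0 1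
  have := (Units.isClosedEmbedding_embedProduct
    (α := Matrix (Fin 2) (Fin 2) K)).isCompact_preimage
    (hball.prod (hball.image MulOpposite.continuous_op))
  convert this using 1
  ext A
  refine ⟨fun h => ⟨h.1, A⁻¹.1, h.2, rfl⟩, ?_⟩
  rintro ⟨h1, B, h2, h3⟩
  have hB : B = A⁻¹.1 := MulOpposite.op_injective h3
  exact ⟨h1, hB ▸ h2⟩

lemma exists_mul_scalar_mem_integralGL [IsUltrametricDist K] {A : GL (Fin 2) K}
    (hA : distortion A = 1) : ∃ u : Kˣ, A * .scalar (Fin 2) u ∈ integralGL K := by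
  obtain ⟨u, hu⟩ := exists_scalar_entryNorm_eq_one A
  refine ⟨u, hu.le, ?_⟩
  rw [← distortion_mul_scalar A u] at hA
  generalize A * .scalar (Fin 2) u = A at hA hu
  rw [Matrix.coe_units_inv, Matrix.inv_def, Ring.inverse_eq_inv', entryNorm_smul,
    entryNorm_adjugate, hu, mul_one, norm_inv]
  rw [distortion, hu, one_pow, one_div] at hA
  exact hA.le

/-- A locally constant function takes finitely many values on a compact set. -/
lemma finite_image_of_locally {X Y : Type*} [TopologicalSpace X] {s : Set X} (hs : IsCompact s)
    (t : Set X) (f : X → Y) (hf : ∀ x ∈ s, ∃ U ∈ nhds x, (f '' (U ∩ t)).Finite) :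
    (f '' (s ∩ t)).Finite := by
  refine hs.induction_on (p := fun s => (f '' (s ∩ t)).Finite) (by simp) ?_ ?_ ?_
  · exact fun a b hab hb => hb.subset (Set.image_mono (Set.inter_subset_inter_left t hab))
  · intro a b ha hb
    rw [Set.union_inter_distrib_right, Set.image_union]
    exact ha.union hb
  · intro x hx
    obtain ⟨U, hU, h⟩ := hf x hx
    exact ⟨U, mem_nhdsWithin_of_mem_nhds hU, h⟩

end Finiteness

variable (p : ℕ) [Fact p.Prime] {K : Type*} [NormedField K] [NormedAlgebra ℚ_[p] K]

/-- A countable closed orbit of circles is discrete, by the Baire category theorem. -/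
lemma exists_nhds_of_isClosed_orbit [ProperSpace K] {Γ : Subgroup PGL(2, K)} [Countable Γ]
    {C : CircleSpace p K} (hC : IsClosed (MulAction.orbit Γ C)) {A : GL (Fin 2) K}
    (hA : mkCircle p K (.mk A) ∈ MulAction.orbit Γ C) :
    ∃ U ∈ nhds A, ∀ B ∈ U, mkCircle p K (.mk B) ∈ MulAction.orbit Γ C →
      mkCircle p K (.mk B) = mkCircle p K (.mk A) := by
  set φ : GL (Fin 2) K → CircleSpace p K := fun A => mkCircle p K (.mk A) with hφ
  have hcont : Continuous φ := by
    have h1 : Continuous (mkCircle p K) := continuous_coinduced_rng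
    have h2 : Continuous (Matrix.ProjGenLinGroup.mk : GL (Fin 2) K → PGL(2, K)) :=
      continuous_coinduced_rng
    exact h1.comp h2
  have hZ : IsClosed (φ ⁻¹' MulAction.orbit Γ C) := hC.preimage hcont
  have hfib : ∀ A₀, IsClosed {A | φ A = φ A₀} := by
    intro A₀
    have h : {A | φ A = φ A₀} = (fun A => A₀⁻¹ * A) ⁻¹'
        {A : GL (Fin 2) K | Matrix.ProjGenLinGroup.mk A • qpLine p K = qpLine p K} := by
      ext A
      simp only [Set.mem_ofPred_eq, Set.mem_preimage, hφ]
      rw [eq_comm, mkCircle_eq_iff, map_mul, map_inv]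
    rw [h]
    exact (isClosed_setOf_smul_qpLine_eq p K).preimage (continuous_const.mul continuous_id)
  have hM : LocallyCompactSpace (Matrix (Fin 2) (Fin 2) K) :=
    inferInstanceAs (LocallyCompactSpace (Fin 2 → Fin 2 → K))
  have hLC : LocallyCompactSpace (φ ⁻¹' MulAction.orbit Γ C) :=
    hZ.isClosedEmbedding_subtypeVal.locallyCompactSpace
  have hne : Nonempty (φ ⁻¹' MulAction.orbit Γ C) := ⟨⟨A, hA⟩⟩
  have hcover : (⋃ γ : Γ, {B : φ ⁻¹' MulAction.orbit Γ C | φ B = γ • C}) = Set.univ := by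
    rw [Set.eq_univ_iff_forall]
    rintro ⟨B, γ, hγ⟩
    exact Set.mem_iUnion.mpr ⟨γ, hγ.symm⟩
  obtain ⟨γ, ⟨B₁, hB₁⟩, hint⟩ := nonempty_interior_of_iUnion_of_closed (fun γ => by
    by_cases h : ∃ A₀, φ A₀ = γ • C
    · obtain ⟨A₀, hA₀⟩ := h
      rw [← hA₀]
      exact (hfib A₀).preimage continuous_subtype_val
    · push Not at h
      simp [h]) hcover
  rw [mem_interior_iff_mem_nhds, mem_nhds_subtype] at hint
  obtain ⟨U, hU, hUsub⟩ := hint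
  have hUB : ∀ B ∈ U, φ B ∈ MulAction.orbit Γ C → φ B = γ • C := fun B hB hBo =>
    hUsub (a := ⟨B, hBo⟩) hB
  have hB₁C : φ B₁ = γ • C := hUB B₁ (mem_of_mem_nhds hU) hB₁
  -- The translation which carries `B₁` to `A` carries the fibre through `B₁` to that through `A`.
  obtain ⟨δ, hδ⟩ := hA
  beta_reduce at hδ
  obtain ⟨D, hD⟩ := Matrix.ProjGenLinGroup.mk_surjective ((δ * γ⁻¹ : Γ) : PGL(2, K))
  have hDB : φ A = φ (D * B₁) := by
    change mkCircle p K (.mk A) = mkCircle p K (.mk (D * B₁))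
    rw [map_mul, ← smul_mkCircle, hD]
    change _ = (δ * γ⁻¹) • φ B₁
    rw [hB₁C, mul_smul, inv_smul_smul, hδ]
  have hh : Matrix.ProjGenLinGroup.mk (A⁻¹ * (D * B₁)) • qpLine p K = qpLine p K := by
    rw [map_mul, map_inv]
    exact (mkCircle_eq_iff p _ _).mp hDB
  have htrans : ∀ B, φ (D⁻¹ * B * (A⁻¹ * (D * B₁))) = (δ * γ⁻¹)⁻¹ • φ B := by
    intro B
    have h1 : φ (D⁻¹ * B * (A⁻¹ * (D * B₁))) = φ (D⁻¹ * B) := by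
      rw [eq_comm]
      change mkCircle p K (.mk (D⁻¹ * B)) = mkCircle p K (.mk (D⁻¹ * B * (A⁻¹ * (D * B₁))))
      rw [mkCircle_eq_iff, ← map_inv, ← map_mul, inv_mul_cancel_left, hh]
    rw [h1]
    change mkCircle p K (.mk (D⁻¹ * B)) = ((δ * γ⁻¹ : Γ)⁻¹ : Γ) • mkCircle p K (.mk B)
    rw [map_mul, map_inv, hD, ← smul_mkCircle]
    rfl
  refine ⟨(fun B => D⁻¹ * B * (A⁻¹ * (D * B₁))) ⁻¹' U, ?_, fun B hB hBo => ?_⟩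
  · refine (Continuous.continuousAt (by fun_prop)).preimage_mem_nhds ?_
    have : D⁻¹ * A * (A⁻¹ * (D * B₁)) = B₁ := by group
    rwa [this]
  · have h1 := hUB _ hB (by
      rw [htrans]
      exact MulAction.mem_orbit_of_mem_orbit _ hBo)
    rw [htrans, inv_smul_eq_iff, mul_smul, inv_smul_smul, hδ] at h1
    exact h1

/-- Only finitely many circles of a countable closed orbit pass through a given vertex, because
the circles through a vertex form a compact set. -/
lemma finite_circles_through [ProperSpace K] {Γ : Subgroup PGL(2, K)} [Countable Γ]
    {C : CircleSpace p K} (hC : IsClosed (MulAction.orbit Γ C)) (x : Vertex p K) :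
    {C' | C' ∈ MulAction.orbit Γ C ∧ x ∈ C'.hull}.Finite := by
  have := isUltrametricDist p K
  obtain ⟨X, rfl⟩ := exists_vertexOf_eq p x
  have hcont : Continuous fun A : GL (Fin 2) K => mkCircle p K (.mk (X * A)) := by
    have h1 : Continuous (mkCircle p K) := continuous_coinduced_rng
    have h2 : Continuous (Matrix.ProjGenLinGroup.mk : GL (Fin 2) K → PGL(2, K)) :=
      continuous_coinduced_rng
    exact h1.comp (h2.comp (continuous_const.mul continuous_id))
  refine Set.Finite.subset (finite_image_of_locally isCompact_integralGL
    {A : GL (Fin 2) K | mkCircle p K (.mk (X * A)) ∈ MulAction.orbit Γ C}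
    (fun A => mkCircle p K (.mk (X * A))) fun A _ => ?_) ?_
  · by_cases hA : mkCircle p K (.mk (X * A)) ∈ MulAction.orbit Γ C
    · obtain ⟨U, hU, hUeq⟩ := exists_nhds_of_isClosed_orbit p hC hA
      refine ⟨(fun B => X * B) ⁻¹' U,
        (Continuous.continuousAt (by fun_prop)).preimage_mem_nhds hU, ?_⟩
      refine (Set.finite_singleton (mkCircle p K (.mk (X * A)))).subset ?_
      rintro - ⟨B, ⟨hB, hBo⟩, rfl⟩
      exact hUeq _ hB hBo
    · refine ⟨_, (hC.isOpen_compl.preimage hcont).mem_nhds hA, ?_⟩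
      convert Set.finite_empty
      rw [Set.image_eq_empty, ← Set.disjoint_iff_inter_eq_empty, Set.disjoint_left]
      exact fun B hB hB' => hB hB'
  · rintro C' ⟨hC', g, rfl, hg⟩
    obtain ⟨A, hA⟩ := Matrix.ProjGenLinGroup.mk_surjective (.mk X⁻¹ * g)
    have hgA : g = .mk (X * A) := by
      rw [map_mul, hA, map_inv, mul_inv_cancel_left]
    subst hgA
    rw [refVertex_eq, refGL_zero, mk_smul_vertexOf, mul_one, eq_comm, vertexOf_eq_iff,
      inv_mul_cancel_left] at hg
    obtain ⟨u, hu⟩ := exists_mul_scalar_mem_integralGL hg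
    have hmk : Matrix.ProjGenLinGroup.mk (X * (A * .scalar (Fin 2) u)) =
        Matrix.ProjGenLinGroup.mk (X * A) := by
      rw [← mul_assoc, map_mul, Matrix.ProjGenLinGroup.mk_scalar, mul_one]
    refine ⟨_, ⟨hu, ?_⟩, ?_⟩
    · rw [Set.mem_ofPred_eq, hmk]
      exact hC'
    · beta_reduce
      rw [hmk]

variable (hK : ∀ x : K, ∃ y : ℚ_[p], ‖x‖ = ‖y‖)
include hK

lemma finite_setOf_dist_eq [ProperSpace K] (x : Vertex p K) (n : ℕ) :
    {y | (tree p K).dist x y = n}.Finite := by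
  have := isUltrametricDist p K
  obtain ⟨X, rfl⟩ := exists_vertexOf_eq p x
  refine Set.Finite.subset (finite_image_of_locally isCompact_integralGL Set.univ
    (fun A => vertexOf p K (X * A * refGL p K n)) fun A _ => ?_) ?_
  · have hcont : Continuous fun B : GL (Fin 2) K =>
        distortion ((X * A * refGL p K n)⁻¹ * (X * B * refGL p K n)) :=
      continuous_distortion.comp (by fun_prop)
    refine ⟨_, ((isOpen_Iio (a := (p : ℝ))).preimage hcont).mem_nhds (x := A) ?_, ?_⟩
    · rw [Set.mem_preimage, inv_mul_cancel, distortion_one]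
      exact one_lt_prime p
    · refine (Set.finite_singleton (vertexOf p K (X * A * refGL p K n))).subset ?_
      rintro - ⟨B, ⟨hB, -⟩, rfl⟩
      have hB' : distortion ((X * A * refGL p K n)⁻¹ * (X * B * refGL p K n)) < p := hB
      rw [Set.mem_singleton_iff, eq_comm]
      change vertexOf p K (X * A * refGL p K n) = vertexOf p K (X * B * refGL p K n)
      rw [distortion_eq_pow_dist p hK] at hB'
      conv_rhs at hB' => rw [← pow_one (p : ℝ)]
      have h0 := (pow_lt_pow_iff_right₀ (one_lt_prime p)).mp hB'
      exact ((tree_connected p hK).dist_eq_zero_iff).mp (by omega)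
  · intro y hy
    obtain ⟨D, m, hD, rfl⟩ := exists_frame p hK (vertexOf p K X) y
    have hDX := hD.symm
    rw [vertexOf_eq_iff] at hDX
    obtain rfl : m = n := by
      rw [← hy, ← hD, eq_comm, dist_eq_iff p hK, inv_mul_cancel_left, distortion_refGL]
    obtain ⟨u, hu⟩ := exists_mul_scalar_mem_integralGL hDX
    refine ⟨_, ⟨hu, Set.mem_univ _⟩, ?_⟩
    beta_reduce
    have hc : X * (X⁻¹ * D * .scalar (Fin 2) u) * refGL p K m =
        D * refGL p K m * .scalar (Fin 2) u := by
      rw [mul_assoc X⁻¹, mul_inv_cancel_left, mul_assoc, mul_assoc]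
      congr 1
      ext i j
      simp [mul_comm]
    rw [hc, vertexOf_mul_scalar]

lemma finite_setOf_dist_le [ProperSpace K] (x : Vertex p K) (n : ℕ) :
    {y | (tree p K).dist x y ≤ n}.Finite := by
  have h : {y | (tree p K).dist x y ≤ n} = ⋃ m ∈ Set.Iic n, {y | (tree p K).dist x y = m} := by
    ext y
    simp
  rw [h]
  exact (Set.finite_Iic n).biUnion fun m _ => finite_setOf_dist_eq p hK x m

/-- A group that acts freely on the orbit of one vertex acts properly on the tree. -/
lemma finite_setOf_dist_smul_le [ProperSpace K] {Γ : Subgroup PGL(2, K)} {x₀ : Vertex p K}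
    (hx₀ : ∀ g ∈ Γ, g • x₀ = x₀ → g = 1) (x y : Vertex p K) (n : ℕ) :
    {g | g ∈ Γ ∧ (tree p K).dist (g • x) y ≤ n}.Finite := by
  refine Set.Finite.of_finite_image (f := fun g => g • x₀) ?_ ?_
  · refine (finite_setOf_dist_le p hK y (n + (tree p K).dist x x₀)).subset ?_
    rintro - ⟨g, ⟨-, hg⟩, rfl⟩
    have h1 := (tree_connected p hK).dist_triangle (u := y) (v := g • x) (w := g • x₀)
    rw [dist_smul p hK, SimpleGraph.dist_comm (u := y) (v := g • x)] at h1
    change (tree p K).dist y (g • x₀) ≤ _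
    omega
  · rintro g ⟨hg, -⟩ k ⟨hk, -⟩ h
    have : g⁻¹ * k = 1 := hx₀ _ (mul_mem (inv_mem hg) hk) (by
      rw [mul_smul, inv_smul_eq_iff]
      exact h.symm)
    exact inv_mul_eq_one.mp this

end BruhatTits

/-! ### Closed orbits of circles -/

namespace BruhatTits

variable (p : ℕ) [Fact p.Prime] {K : Type*} [NormedField K] [NormedAlgebra ℚ_[p] K]

lemma mem_circleStabilizer_iff {Γ : Subgroup PGL(2, K)} {C : CircleSpace p K} {g : PGL(2, K)} :
    g ∈ circleStabilizer Γ C ↔ g ∈ Γ ∧ g • C = C := by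
  rw [circleStabilizer, Subgroup.mem_inf, MulAction.mem_stabilizer_iff]

lemma limitSet_mono {Γ Δ : Subgroup PGL(2, K)} (h : Δ ≤ Γ) : limitSet p Δ ⊆ limitSet p Γ := by
  rintro ξ ⟨g, hg, hn⟩
  refine ⟨g, hg, fun n => ?_⟩
  obtain ⟨γ, hγ, hmem⟩ := hn n
  exact ⟨γ, h hγ, hmem⟩

variable (hK : ∀ x : K, ∃ y : ℚ_[p], ‖x‖ = ‖y‖)
include hK

/-- The limit set of a group which preserves a circle is contained in that circle. -/
lemma limitSet_subset_points {Δ : Subgroup PGL(2, K)} {C : CircleSpace p K}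
    (hΔ : ∀ g ∈ Δ, g • C = C) : limitSet p Δ ⊆ C.points := by
  have hT := tree_uniqueDescent p hK
  intro ξ hξ
  obtain ⟨g, rfl, -⟩ := id hξ
  rw [smul_infPt_mem_limitSet_iff p hK] at hξ
  obtain ⟨c, hc⟩ := hull_nonempty p C
  obtain ⟨N, hN⟩ := hT.exists_forall_ray_mem (ray_adj p hK g) (ray_ne p hK g)
    (hull_separationConvex p hK C) hc fun n => by
      obtain ⟨δ, hδ, hmem⟩ := hξ (n + (tree p K).dist c (refVertex p K 0))
      refine ⟨δ • c, ?_, hT.mem_half_ray_of_dist_le (ray_adj p hK g) (ray_ne p hK g)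
        (dist_smul p hK δ c (refVertex p K 0)).le le_rfl hmem⟩
      have := smul_mem_hull p δ hc
      rwa [hΔ δ hδ] at this
  exact smul_infPt_mem_points p hN

/-- If the orbit of `C` is closed, then the stabilizer of `C` acts cocompactly on the part of the
subtree of `C` which lies near the orbit of the origin: there are finitely many vertices up to `Γ`
near the orbit, and through each of them there pass only finitely many circles `γ C`. -/
lemma exists_finite_fundamental_set [ProperSpace K] {Γ : Subgroup PGL(2, K)} [Countable Γ]
    {C : CircleSpace p K} (hC : IsClosed (MulAction.orbit Γ C)) (R : ℕ) :
    ∃ F : Set (Vertex p K), F.Finite ∧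
      F ⊆ C.hull ∩ {x | ∃ g ∈ Γ, (tree p K).dist (g • refVertex p K 0) x ≤ R} ∧
      ∀ x ∈ C.hull ∩ {x | ∃ g ∈ Γ, (tree p K).dist (g • refVertex p K 0) x ≤ R},
        ∃ g ∈ circleStabilizer Γ C, ∃ f ∈ F, x = g • f := by
  have hk : ∀ C' : CircleSpace p K, ∃ k ∈ Γ, C' ∈ MulAction.orbit Γ C → k • C' = C := by
    intro C'
    by_cases h : C' ∈ MulAction.orbit Γ C
    · obtain ⟨δ, rfl⟩ := h
      exact ⟨(δ⁻¹ : Γ), (δ⁻¹).2, fun _ => inv_smul_smul δ C⟩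
    · exact ⟨1, one_mem _, fun h' => absurd h' h⟩
  choose k hkΓ hkC using hk
  refine ⟨⋃ f ∈ {y | (tree p K).dist (refVertex p K 0) y ≤ R},
    (fun C' => k C' • f) '' {C' | C' ∈ MulAction.orbit Γ C ∧ f ∈ C'.hull}, ?_, ?_, ?_⟩
  · exact (finite_setOf_dist_le p hK _ R).biUnion fun f _ => (finite_circles_through p hC f).image _
  · intro x hx
    simp only [Set.mem_iUnion] at hx
    obtain ⟨f, hf, C', ⟨hC', hfC'⟩, rfl⟩ := hx
    refine ⟨?_, k C', hkΓ C', ?_⟩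
    · have := smul_mem_hull p (k C') hfC'
      rwa [hkC C' hC'] at this
    · rw [dist_smul p hK]
      exact hf
  · rintro x ⟨hx, γ, hγ, hd⟩
    have hC' : γ⁻¹ • C ∈ MulAction.orbit Γ C := ⟨⟨γ⁻¹, inv_mem hγ⟩, rfl⟩
    refine ⟨γ * (k (γ⁻¹ • C))⁻¹, ?_, k (γ⁻¹ • C) • γ⁻¹ • x, ?_, ?_⟩
    · rw [mem_circleStabilizer_iff]
      refine ⟨mul_mem hγ (inv_mem (hkΓ _)), ?_⟩
      rw [mul_smul]
      have : (k (γ⁻¹ • C))⁻¹ • C = γ⁻¹ • C := by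
        rw [inv_smul_eq_iff]
        exact (hkC _ hC').symm
      rw [this, smul_inv_smul]
    · simp only [Set.mem_iUnion]
      refine ⟨γ⁻¹ • x, ?_, γ⁻¹ • C, ⟨hC', smul_mem_hull p _ hx⟩, rfl⟩
      change (tree p K).dist _ _ ≤ R
      rwa [← dist_smul p hK γ, smul_inv_smul]
    · rw [mul_smul, inv_smul_smul, smul_inv_smul]

end BruhatTits

open BruhatTits in
theorem theorem4p3 (p : ℕ) [Fact p.Prime] (hp : p ≠ 2)
    (K : Type*) [NormedField K] [NormedAlgebra ℚ_[p] K]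
    (hK : BruhatTits.IsUnramifiedQuadratic p K)
    (Γ : Subgroup PGL(2, K)) (hΓ : BruhatTits.IsSchottky p Γ)
    (C : BruhatTits.CircleSpace p K)
    (hclosed : IsClosed (MulAction.orbit Γ C))
    (hmeet : (C.points ∩ BruhatTits.limitSet p Γ).Nonempty) :
    (BruhatTits.circleStabilizer Γ C).FG ∧
      C.points ∩ BruhatTits.limitSet p Γ =
        BruhatTits.limitSet p (BruhatTits.circleStabilizer Γ C) := by
  have hun := hK.unramified
  have hfin : FiniteDimensional ℚ_[p] K :=
    FiniteDimensional.of_finrank_pos (by rw [hK.finrank_eq_two]; exact two_pos)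
  have hproper : ProperSpace K := FiniteDimensional.proper ℚ_[p] K
  have hT := tree_uniqueDescent p hun
  obtain ⟨n, γ, hn, hγ, rfl⟩ := hΓ
  have hcount := countable_closure_range γ
  obtain ⟨x₁, hx₁⟩ := exists_stabilizer_trivial p hun hn hγ
  set Γ := Subgroup.closure (Set.range γ)
  set x₀ := refVertex p K 0
  obtain ⟨R, hR⟩ : ∃ R : ℕ, ∀ g ∈ Set.range γ, (tree p K).dist x₀ (g • x₀) ≤ R := by
    refine ⟨Finset.univ.sup fun i => (tree p K).dist x₀ (γ i • x₀), ?_⟩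
    rintro - ⟨i, rfl⟩
    exact Finset.le_sup (f := fun i => (tree p K).dist x₀ (γ i • x₀)) (Finset.mem_univ i)
  have hX := hT.separationConvex_nhds_orbit (dist_smul p hun) hR
  obtain ⟨F, hF, hFS, hcov⟩ := exists_finite_fundamental_set p hun hclosed R
  set X := {x | ∃ g ∈ Γ, (tree p K).dist (g • x₀) x ≤ R}
  have hS := (hull_separationConvex p hun C).inter hX
  have hΓX : ∀ g ∈ Γ, g • x₀ ∈ X := fun g hg => ⟨g, hg, by simp⟩
  -- A ray in the subtree of `C` towards a limit point eventually stays in the convex set `X`.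
  have hray : ∀ g, mkCircle p K g = C → g • infPt K ∈ limitSet p Γ →
      ∃ N : ℕ, ∀ m : ℕ, N ≤ m → g • refVertex p K (-(m : ℤ)) ∈ C.hull ∩ X := by
    intro g hg hlim
    rw [smul_infPt_mem_limitSet_iff p hun] at hlim
    obtain ⟨N, hN⟩ := hT.exists_forall_ray_mem (ray_adj p hun g) (ray_ne p hun g) hX
      (hΓX 1 (one_mem _)) fun m => by
        obtain ⟨δ, hδ, hmem⟩ := hlim m
        exact ⟨δ • x₀, hΓX δ hδ, hmem⟩
    exact ⟨N, fun m hm => ⟨smul_refVertex_mem_hull p hg _, hN m hm⟩⟩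
  refine ⟨?_, Set.Subset.antisymm ?_ ?_⟩
  · obtain ⟨ξ, hξC, hξ⟩ := hmeet
    obtain ⟨g, hg, rfl⟩ := exists_smul_infPt_eq p hξC
    obtain ⟨N, hN⟩ := hray g hg hξ
    refine hT.fg_of_cocompact (dist_smul p hun) hS ⟨_, hN N le_rfl⟩ ?_ hF hFS hcov
      fun f _ f' _ => ?_
    · rintro k hk x ⟨hxC, δ, hδ, hd⟩
      rw [mem_circleStabilizer_iff] at hk
      refine ⟨?_, k * δ, mul_mem hk.1 hδ, ?_⟩
      · have := smul_mem_hull p k hxC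
        rwa [hk.2] at this
      · rwa [mul_smul, dist_smul p hun]
    · refine (finite_setOf_dist_smul_le p hun hx₁ f f' 1).subset ?_
      rintro k ⟨hk, hd⟩
      exact ⟨((mem_circleStabilizer_iff p).mp hk).1, hd⟩
  · rintro ξ ⟨hξC, hξ⟩
    obtain ⟨g, hg, rfl⟩ := exists_smul_infPt_eq p hξC
    obtain ⟨N, hN⟩ := hray g hg hξ
    obtain ⟨D, hD⟩ : ∃ D : ℕ, ∀ f ∈ F, (tree p K).dist x₀ f ≤ D := by
      obtain ⟨D, hD⟩ := (hF.image fun f => (tree p K).dist x₀ f).bddAbove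
      exact ⟨D, fun f hf => hD (Set.mem_image_of_mem _ hf)⟩
    rw [smul_infPt_mem_limitSet_iff p hun]
    intro m
    obtain ⟨δ, hδ, f, hf, hδf⟩ := hcov _ (hN (max N (m + D) + 1) (by omega))
    refine ⟨δ, hδ, hT.mem_half_ray_of_dist_le (ray_adj p hun g) (ray_ne p hun g) (R := D) ?_
      (le_max_right N (m + D))
      (SimpleGraph.UniqueDescent.right_mem_half (ray_adj p hun g _))⟩
    rw [hδf, dist_smul p hun]
    exact hD f hf
  · intro ξ hξ
    exact ⟨limitSet_subset_points p hun (fun g hg => ((mem_circleStabilizer_iff p).mp hg).2) hξ,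
      limitSet_mono p (fun g hg => ((mem_circleStabilizer_iff p).mp hg).1) hξ⟩
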